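/- Let $d_r,d_c,\mathfrak r\ge 1$ be integers and let $\alpha_1,\alpha_2>0$. There are constants $\alpha_3,\alpha_4,\alpha_5>0$, depending only on $d_r,d_c,\mathfrak r,\alpha_1,\alpha_2$, such that the following holds. Let $B^*\in\mathbb R^{d_r\times d_c}$ have rank $\mathfrak r$. Denote by $B_j$ the $j$-th row of a matrix $B$ and set $\|B\|_{\infty,2}=\max_j\|B_j\|_2$. Let $D_{\mathfrak r\mathfrak r}$ be the smallest nonzero singular value of $B^*$, let $\mu^*=\sqrt{d_r/\mathfrak r}\,\|B^*\|_{\infty,2}/D_{\mathfrak r\mathfrak r}$, and for $h>0$ let $\gamma(h)=\sqrt{d_r/\mathfrak r}\cdot h/(64\mu^*)$. Let $\rho\ge\max\{32,\ 32d_r/\alpha_3,\ \alpha_4\gamma(h)^{-2},\ \alpha_5/h\}$ and let $t\ge 2\rho\log\rho$ be an integer. *Observations.* For rounds $s=1,2,\dots$ let $f_s\in([d_r]\times[d_c])\cup\{\emptyset\}$ be random with $\mathbb P(f_s=(j,k))=\frac1{d_rd_c}$ for all $(j,k)$ if $s\le 2\rho\log\rho$, and $\mathbb P(f_s=(j,k))=\frac{\rho}{d_rd_c(s-\rho\log\rho+1)}$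 if $s>2\rho\log\rho$. Let $\epsilon_s$ be $1$-subgaussian, with all $f_s$ and $\epsilon_s$ mutually independent. Whenever $f_s\ne\emptyset$, the entry $f_s$ is played, and $y_s=B^*_{f_s}+\epsilon_s$ is observed; in the other rounds any entry may be played. Let $\mathcal F_t=\{1\le s\le t: f_s\neq\emptyset\}$. *Low-rank estimator.* Let $\bar B$ be a (measurable) map that sends finite sequences of observations to $d_r\times d_c$ matrices and satisfies the following tail bound. For all $\delta>0$, $n\ge2$ and $1\le s_1<\dots<s_n$ with $n/\log n\ge\alpha_2(1+\delta^{-2})\mathfrak r(d_r+d_c)$, if $\bar B$ is computed from $n$ observations $(X_i,\,B^*_{X_i}+\eta_i)$, where $X_1,\dots,X_n$ are uniform on $[d_r]\times[d_c]$, $\eta_i$ has the law of $\epsilon_{s_i}$, and all of these are independent, then $$\mathbb P(\|\bar B-B^*\|_F\ge\delta)\le\exp\Big(-\frac{\alpha_1\delta^2n}{(d_r+d_c)\mathfrak r}\Big).$$ (If the $\epsilon_s$ are identically distributed, this is the bound for $n$ i.i.d. observations.) *Row enhancement.* Let $\mathcal J_1$ be the first $\lfloor|\mathcal F_t|/2\rfloor$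 rounds of $\mathcal F_t$ and $\mathcal J_2$ the remaining ones. Let $V_{\mathfrak r}$ consist of the first $\mathfrak r$ right singular vectors in a singular value decomposition of $\bar B(\mathcal J_1)$. For each $j\in[d_r]$ let $\hat\vartheta_j$ be a minimizer over $\vartheta\in\mathbb R^{\mathfrak r}$ of $\sum_s(y_s-(V_{\mathfrak r}\vartheta)_{k_s})^2$, where the sum runs over the rounds $s\in\mathcal J_2$ with $f_s=(j,k_s)$, and let $\hat B^F_j=(V_{\mathfrak r}\hat\vartheta_j)^\top$ be the $j$-th row of $\hat B^F$. Ties in these choices are broken arbitrarily. Then for each $j\in[d_r]$, with probability at least $1-9t^{-3}$, $$\|\hat B^F_j-B^*_j\|_2\le \frac h4 .$$ -/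

import Mathlib

open MeasureTheory ProbabilityTheory

noncomputable section

namespace LowRankBandit

variable {dr dc : ℕ}

/-! ### Matrices -/

/-- Euclidean norm of the `j`-th row of `A`. -/
def rowNorm (A : Matrix (Fin dr) (Fin dc) ℝ) (j : Fin dr) : ℝ :=
  √(∑ k, A j k ^ 2)

/-- Frobenius norm of `A`. -/
def frobNorm (A : Matrix (Fin dr) (Fin dc) ℝ) : ℝ :=
  √(∑ j, ∑ k, A j k ^ 2)

/-- The norm `‖A‖_{∞,2}`: the largest Euclidean norm of a row. -/
def maxRowNorm (A : Matrix (Fin dr) (Fin dc) ℝ) : ℝ :=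
  ⨆ j, rowNorm A j

/-- The smallest nonzero singular value `D_{𝔯𝔯}` of a matrix of rank `𝔯 ≥ 1`
(Mathlib numbers the singular values, in decreasing order, from `0`). -/
def minSingularValue (A : Matrix (Fin dr) (Fin dc) ℝ) : ℝ :=
  (Matrix.toEuclideanLin A).singularValues (A.rank - 1)

/-- Row-incoherence `μ(A) = √(d_r / 𝔯) * ‖A‖_{∞,2} / D_{𝔯𝔯}`, where `𝔯 = rank A`. -/
def rowIncoherence (A : Matrix (Fin dr) (Fin dc) ℝ) : ℝ :=
  √((dr : ℝ) / A.rank) * (maxRowNorm A / minSingularValue A)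

/-- `γ(h) = √(d_r / 𝔯) * h / (64 μ(A))`. -/
def gammaRes (A : Matrix (Fin dr) (Fin dc) ℝ) (h : ℝ) : ℝ :=
  √((dr : ℝ) / A.rank) * (h / (64 * rowIncoherence A))

/-- `A = U D Vᵀ` is a (full) singular value decomposition: `U`, `V` orthogonal, `D` rectangular
diagonal with nonnegative nonincreasing diagonal. -/
structure IsSVD (A : Matrix (Fin dr) (Fin dc) ℝ) (U : Matrix (Fin dr) (Fin dr) ℝ)
    (D : Matrix (Fin dr) (Fin dc) ℝ) (V : Matrix (Fin dc) (Fin dc) ℝ) : Prop where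
  left_orthogonal : U ∈ Matrix.orthogonalGroup (Fin dr) ℝ
  right_orthogonal : V ∈ Matrix.orthogonalGroup (Fin dc) ℝ
  off_diagonal : ∀ (i : Fin dr) (k : Fin dc), (i : ℕ) ≠ k → D i k = 0
  diagonal_nonneg : ∀ (i : Fin dr) (k : Fin dc), (i : ℕ) = k → 0 ≤ D i k
  diagonal_antitone : ∀ (i i' : Fin dr) (k k' : Fin dc), (i : ℕ) = k → (i' : ℕ) = k' →
    i ≤ i' → D i' k' ≤ D i k
  eq_mul : A = U * D * V.transpose

/-- The matrix formed by the first `r` columns of `V`. -/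
def firstCols (V : Matrix (Fin dc) (Fin dc) ℝ) (r : ℕ) :
    Matrix (Fin dc) {k : Fin dc // (k : ℕ) < r} ℝ :=
  V.submatrix id Subtype.val

/-! ### Low-rank estimators and their tail bound -/

/-- A low-rank estimator: it turns any finite sequence of observations (an entry position together
with an observed reward) into a matrix. -/
abbrev Estimator (dr dc : ℕ) : Type :=
  (n : ℕ) → (Fin n → (Fin dr × Fin dc) × ℝ) → Matrix (Fin dr) (Fin dc) ℝ

/-- Measurability of an estimator in its data. -/
def Estimator.IsMeasurable (Bbar : Estimator dr dc) : Prop :=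
  ∀ (n : ℕ) (j : Fin dr) (k : Fin dc), Measurable fun z => Bbar n z j k

/-- The tail bound for a low-rank estimator with constants `α₁`, `α₂`, when the observation noise
of round `s` has law `ν s`. The `n` observations are taken at rounds `s₀ < s₁ < ⋯`: their positions
are i.i.d. uniform on `[d_r] × [d_c]` and independent of the noises, which are independent. If all
`ν s` agree, this is the bound for `n` i.i.d. observations. -/
def TailBound (Bbar : Estimator dr dc) (Bstar : Matrix (Fin dr) (Fin dc) ℝ)
    (ν : ℕ → Measure ℝ) (α₁ α₂ : ℝ) : Prop :=
  ∀ (n : ℕ) (s : Fin n → ℕ), 2 ≤ n → StrictMono s → (∀ i, 1 ≤ s i) →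
    ∀ δ : ℝ, 0 < δ →
      α₂ * (1 + (δ ^ 2)⁻¹) * Bstar.rank * (dr + dc) ≤ n / Real.log n →
      (Measure.pi fun i : Fin n =>
          (uniformOn (Set.univ : Set (Fin dr × Fin dc))).prod (ν (s i)))
        {z | δ ≤ frobNorm
          (Bbar n (fun i => ((z i).1, Bstar (z i).1.1 (z i).1.2 + (z i).2)) - Bstar)}
      ≤ ENNReal.ofReal (Real.exp (-(α₁ * δ ^ 2 * n / ((dr + dc) * Bstar.rank))))

/-! ### Forced sampling -/

/-- Probability that a given arm is forced at round `s`. -/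
def forcedProb (dr dc : ℕ) (ρ : ℝ) (s : ℕ) : ℝ :=
  if (s : ℝ) ≤ 2 * ρ * Real.log ρ then 1 / (dr * dc)
  else ρ / (dr * dc * (s - ρ * Real.log ρ + 1))

/-- The set `𝓕_t` of rounds `1 ≤ s ≤ t` in which an arm is forced (`none` means: no forcing). -/
def forcedRounds (f : ℕ → Option (Fin dr × Fin dc)) (t : ℕ) : Finset ℕ :=
  (Finset.Icc 1 t).filter fun s => (f s).isSome

/-! ### Row enhancement -/

/-- The earliest `⌊|J| / 2⌋` rounds of `J`. -/
def firstHalf (J : Finset ℕ) : Finset ℕ :=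
  J.filter fun s => (J.filter fun s' => s' < s).card < J.card / 2

/-- The remaining rounds of `J`. -/
def secondHalf (J : Finset ℕ) : Finset ℕ :=
  J \ firstHalf J

/-- The observations made in the rounds of `J`, in chronological order. -/
def observations (arm : ℕ → Fin dr × Fin dc) (y : ℕ → ℝ) (J : Finset ℕ) :
    Fin J.card → (Fin dr × Fin dc) × ℝ :=
  fun i => (arm (J.orderEmbOfFin rfl i), y (J.orderEmbOfFin rfl i))

/-- Squared loss of the coefficient vector `θ` on the observations of row `j` in the rounds
of `J`, with the rows of `W` as regressors. -/
def rowLoss {ι : Type} [Fintype ι] (W : Matrix (Fin dc) ι ℝ) (arm : ℕ → Fin dr × Fin dc)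
    (y : ℕ → ℝ) (J : Finset ℕ) (j : Fin dr) (θ : ι → ℝ) : ℝ :=
  ∑ s ∈ J with (arm s).1 = j, (y s - W.mulVec θ (arm s).2) ^ 2

/-- `Bhat` is an output of the row-enhancement procedure with rank `r` and low-rank estimator
`Bbar` on the observations `(arm s, y s)`, `s ∈ J`: with `V_r` the first `r` right singular vectors
in a singular value decomposition of `Bbar` on the first half of `J`, each row `j` of `Bhat` is
`V_r θ` for a least-squares solution `θ` on the row-`j` observations of the second half of `J`.
Any choice of the decomposition and of the minimizers is allowed. -/
def IsRowEnhancement (r : ℕ) (Bbar : Estimator dr dc) (arm : ℕ → Fin dr × Fin dc) (y : ℕ → ℝ)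
    (J : Finset ℕ) (Bhat : Matrix (Fin dr) (Fin dc) ℝ) : Prop :=
  ∃ U D V, IsSVD (Bbar (firstHalf J).card (observations arm y (firstHalf J))) U D V ∧
    ∀ j, ∃ θ,
      (∀ θ', rowLoss (firstCols V r) arm y (secondHalf J) j θ ≤
        rowLoss (firstCols V r) arm y (secondHalf J) j θ') ∧
      Bhat j = (firstCols V r).mulVec θ

end LowRankBandit

end

/-!
# Accuracy of row-enhanced low-rank estimation under forced sampling

Since the constants may depend on the dimensions, no sharp singular subspace perturbation bound is
needed, and the argument is a deterministic estimate on a favourable event.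

*Deterministic part.* Let `κ = 1 / (2 d_r d_c)`, `H = h / 4`, `δ = κ H / 8`. If `‖B̄ - B*‖_F < δ`,
then each row of `B*` lies within `2 δ` of the span of the first `𝔯` right singular vectors of `B̄`
(`IsSVD.exists_firstCols_mulVec_near`): by a Weyl-type inequality the first discarded singular
value of `B̄` is at most `δ`, because `rank B* = 𝔯`. If moreover, on the second half of the forced
rounds, each entry of row `j` is observed at least a fraction `κ` of the time and its noise sum is
a small fraction of the number of rounds, comparing the squared loss of the minimizer with that of
the nearby vector in the span bounds the error of row `j` by `H`
(`sum_sq_leastSquares_error_le`).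

*Probabilistic part.* Conditionally on the set `S` of forced rounds, the observations are
independent with uniform positions and unchanged noise laws (`cond_rounds`). So the assumed tail
bound applies to the first half of `S`, while Hoeffding's inequality for the counts and for the
noise sums applies to the second half. Each failure probability is of order `t⁻³` as soon as
`|S| ≥ ρ log t / 8` and `ρ` exceeds a multiple of `1 + h⁻²` (`cond_not_goodSample_le`). The number
of forced rounds has mean at least `ρ log t / 2` (`le_sum_forcedProb`), so a Chernoff bound gives
`|S| ≥ ρ log t / 8` outside an event of probability `t⁻³`. Finally `γ(h)⁻² ≥ 4096 / (d_r h²)`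
(`inv_sq_gammaRes_ge`), because the smallest nonzero singular value is at most
`‖B*‖_F ≤ √d_r ‖B*‖_{∞,2}`; hence the assumption `ρ ≥ α₄ γ(h)⁻²` makes `ρ h²` large.
-/

namespace LowRankBandit

open Matrix

variable {dr dc : ℕ}

/-! ### Matrix norms and the resolution `γ(h)` -/

lemma sum_sq_orthogonal_mulVec {n : ℕ} {U : Matrix (Fin n) (Fin n) ℝ}
    (hU : U ∈ Matrix.orthogonalGroup (Fin n) ℝ) (x : Fin n → ℝ) :
    ∑ i, (U *ᵥ x) i ^ 2 = ∑ i, x i ^ 2 := by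
  have h : Uᵀ * U = 1 := by
    have := (Matrix.mem_orthogonalGroup_iff' (Fin n) ℝ).1 hU
    simpa [Matrix.star_eq_conjTranspose] using this
  have e : ∀ y : Fin n → ℝ, ∑ i, y i ^ 2 = y ⬝ᵥ y := fun y => by
    simp [dotProduct, sq]
  rw [e, e, Matrix.dotProduct_mulVec, Matrix.vecMul_mulVec, h, Matrix.vecMul_one]

lemma sq_frobNorm (A : Matrix (Fin dr) (Fin dc) ℝ) :
    frobNorm A ^ 2 = ∑ j, ∑ k, A j k ^ 2 :=
  Real.sq_sqrt (by positivity)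

lemma sum_sq_mulVec_le (A : Matrix (Fin dr) (Fin dc) ℝ) (x : Fin dc → ℝ) :
    ∑ i, (A *ᵥ x) i ^ 2 ≤ frobNorm A ^ 2 * ∑ k, x k ^ 2 := by
  rw [sq_frobNorm, Finset.sum_mul]
  exact Finset.sum_le_sum fun i _ => Finset.sum_mul_sq_le_sq_mul_sq Finset.univ (A i) x

/-- The smallest nonzero singular value is at most the Frobenius norm. -/
lemma minSingularValue_le_frobNorm {A : Matrix (Fin dr) (Fin dc) ℝ} (hA : 1 ≤ A.rank) :
    minSingularValue A ≤ frobNorm A := by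
  have hdc : A.rank ≤ dc := by simpa using A.rank_le_width
  have hlt : A.rank - 1 < Module.finrank ℝ (EuclideanSpace ℝ (Fin dc)) := by
    rw [finrank_euclideanSpace_fin]; omega
  obtain ⟨v, hv⟩ :=
    ((Matrix.toEuclideanLin A).hasEigenvalue_adjoint_comp_self_sq_singularValues
      hlt).exists_hasEigenvector
  have h1 := hv.apply_eq_smul
  have h2 : ‖Matrix.toEuclideanLin A v‖ ^ 2 = minSingularValue A ^ 2 * ‖v‖ ^ 2 := by
    rw [← real_inner_self_eq_norm_sq, ← LinearMap.adjoint_inner_left]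
    have h1' : LinearMap.adjoint (Matrix.toEuclideanLin A) (Matrix.toEuclideanLin A v)
        = (minSingularValue A ^ 2 : ℝ) • v := by
      simpa [minSingularValue] using h1
    rw [h1', real_inner_smul_left, real_inner_self_eq_norm_sq]
  have h3 : ‖Matrix.toEuclideanLin A v‖ ^ 2 ≤ frobNorm A ^ 2 * ‖v‖ ^ 2 := by
    rw [EuclideanSpace.real_norm_sq_eq, EuclideanSpace.real_norm_sq_eq]
    exact sum_sq_mulVec_le A v.ofLp
  have hv0 : 0 < ‖v‖ ^ 2 := by
    have := norm_pos_iff.2 hv.2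
    positivity
  rw [h2] at h3
  have hD0 : 0 ≤ minSingularValue A := LinearMap.singularValues_nonneg _ _
  exact (pow_le_pow_iff_left₀ hD0 (Real.sqrt_nonneg _) two_ne_zero).1
    (le_of_mul_le_mul_right h3 hv0)

lemma minSingularValue_pos {A : Matrix (Fin dr) (Fin dc) ℝ} (hA : 1 ≤ A.rank) :
    0 < minSingularValue A := by
  refine LinearMap.singularValues_pos_iff_lt_finrank_range _ |>.2 ?_
  have : Module.finrank ℝ (Matrix.toEuclideanLin A).range = A.rank := by
    rw [Matrix.rank_eq_finrank_range_toLin A (EuclideanSpace.basisFun (Fin dr) ℝ).toBasis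
      (EuclideanSpace.basisFun (Fin dc) ℝ).toBasis]
    rfl
  omega

lemma frobNorm_le_maxRowNorm (A : Matrix (Fin dr) (Fin dc) ℝ) :
    frobNorm A ≤ √dr * maxRowNorm A := by
  have h0 : 0 ≤ maxRowNorm A := Real.iSup_nonneg fun _ => Real.sqrt_nonneg _
  refine (pow_le_pow_iff_left₀ (a := frobNorm A) (Real.sqrt_nonneg _) (by positivity)
    two_ne_zero).1 ?_
  rw [sq_frobNorm, mul_pow, Real.sq_sqrt (by positivity)]
  calc ∑ j, ∑ k, A j k ^ 2 ≤ ∑ _j : Fin dr, maxRowNorm A ^ 2 := by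
        refine Finset.sum_le_sum fun j _ => ?_
        have : rowNorm A j ≤ maxRowNorm A :=
          le_ciSup (f := fun j => rowNorm A j) (Set.finite_range _).bddAbove j
        calc ∑ k, A j k ^ 2 = rowNorm A j ^ 2 := (Real.sq_sqrt (by positivity)).symm
          _ ≤ _ := pow_le_pow_left₀ (Real.sqrt_nonneg _) this 2
    _ = _ := by simp

/-- Up to a dimensional factor `γ(h)` is at most `h`, because the incoherence is bounded below. -/
lemma inv_sq_gammaRes_ge {A : Matrix (Fin dr) (Fin dc) ℝ} (hA : 1 ≤ A.rank) {h : ℝ} (hh : 0 < h) :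
    4096 / (dr * h ^ 2) ≤ (gammaRes A h ^ 2)⁻¹ := by
  have hD := minSingularValue_pos hA
  have hdr : 0 < (dr : ℝ) := by
    have : A.rank ≤ dr := by simpa using A.rank_le_height
    exact_mod_cast (by omega : 0 < dr)
  have hr : (0 : ℝ) < A.rank := by exact_mod_cast hA
  have hM : minSingularValue A ≤ √dr * maxRowNorm A :=
    (minSingularValue_le_frobNorm hA).trans (frobNorm_le_maxRowNorm A)
  have hM0 : 0 < maxRowNorm A := by
    by_contra hc
    have := mul_nonpos_of_nonneg_of_nonpos (Real.sqrt_nonneg (dr : ℝ)) (not_lt.1 hc)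
    linarith
  have h2 : (gammaRes A h ^ 2)⁻¹ = 4096 * (maxRowNorm A / minSingularValue A) ^ 2 / h ^ 2 := by
    have hs : √((dr : ℝ) / A.rank) ≠ 0 := by positivity
    unfold gammaRes rowIncoherence
    field_simp
    norm_num
  have h3 : (1 : ℝ) / dr ≤ (maxRowNorm A / minSingularValue A) ^ 2 := by
    rw [div_pow, div_le_div_iff₀ hdr (by positivity)]
    have := pow_le_pow_left₀ hD.le hM 2
    rw [mul_pow, Real.sq_sqrt hdr.le] at this
    linarith
  rw [h2]
  calc 4096 / (dr * h ^ 2) = 4096 * (1 / (dr : ℝ)) / h ^ 2 := by field_simp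
    _ ≤ _ := by gcongr

/-! ### Approximation of a row in the span of the leading right singular vectors -/

lemma exists_mulVec_eq_zero_of_rank_lt {ι : Type} [Fintype ι] [DecidableEq ι]
    (M : Matrix (Fin dr) ι ℝ) (h : M.rank < Fintype.card ι) :
    ∃ z : ι → ℝ, z ≠ 0 ∧ M *ᵥ z = 0 := by
  by_contra! hc
  have hinj : LinearMap.ker M.mulVecLin = ⊥ := by
    rw [LinearMap.ker_eq_bot']
    intro z hz
    by_contra h0
    exact hc z h0 hz
  have := LinearMap.finrank_range_add_finrank_ker M.mulVecLin
  rw [hinj] at this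
  simp only [finrank_bot, add_zero, Module.finrank_fintype_fun_eq_card] at this
  unfold Matrix.rank at h
  omega

/-- A combination of the first `r` columns of `V`, as `V` applied to the coefficient vector `z`
extended by zero. -/
lemma firstCols_mulVec (V : Matrix (Fin dc) (Fin dc) ℝ) (r : ℕ)
    (θ : {k : Fin dc // (k : ℕ) < r} → ℝ) (z : Fin dc → ℝ) (hz : ∀ k, z k.1 = θ k)
    (hz' : ∀ k : Fin dc, r ≤ k → z k = 0) : firstCols V r *ᵥ θ = V *ᵥ z := by
  ext i
  simp only [mulVec, dotProduct, firstCols, submatrix_apply, id]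
  have : ∑ k, V i k * z k =
      ∑ k ∈ Finset.univ.filter (fun k : Fin dc => (k : ℕ) < r), V i k * z k := by
    rw [Finset.sum_filter]
    refine Finset.sum_congr rfl fun k _ => ?_
    split_ifs with hk
    · rfl
    · rw [hz' k (not_lt.1 hk), mul_zero]
  rw [this, Finset.sum_subtype (p := fun k : Fin dc => (k : ℕ) < r) _ (by simp)]
  exact Finset.sum_congr rfl fun k _ => by rw [hz]

namespace IsSVD

variable {A : Matrix (Fin dr) (Fin dc) ℝ} {U : Matrix (Fin dr) (Fin dr) ℝ}
  {D : Matrix (Fin dr) (Fin dc) ℝ} {V : Matrix (Fin dc) (Fin dc) ℝ}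

/-- The columns of the rectangular diagonal matrix `D` are orthogonal. Their squared norms are the
squared singular values, with value `0` for the columns beyond the number of rows. -/
lemma sum_sq_diagonal_mulVec (hS : IsSVD A U D V) (z : Fin dc → ℝ) :
    ∑ i, (D *ᵥ z) i ^ 2 = ∑ k, (∑ i, D i k ^ 2) * z k ^ 2 := by
  simp_rw [Finset.sum_mul]
  rw [Finset.sum_comm]
  refine Finset.sum_congr rfl fun i _ => ?_
  by_cases hi : (i : ℕ) < dc
  · have hne : ∀ k : Fin dc, k ≠ ⟨i, hi⟩ → D i k = 0 := fun k hk =>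
      hS.off_diagonal i k fun h => hk (Fin.ext h.symm)
    rw [mulVec, dotProduct, Finset.sum_eq_single (⟨i, hi⟩ : Fin dc) _ (by simp),
      Finset.sum_eq_single (⟨i, hi⟩ : Fin dc) _ (by simp), mul_pow]
    · intro k _ hk; simp [hne k hk]
    · intro k _ hk; simp [hne k hk]
  · have hne : ∀ k : Fin dc, D i k = 0 := fun k =>
      hS.off_diagonal i k fun h => hi (h ▸ k.2)
    simp [mulVec, dotProduct, hne]

lemma sum_sq_column_antitone (hS : IsSVD A U D V) {k k' : Fin dc} (hk : k ≤ k') :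
    ∑ i, D i k' ^ 2 ≤ ∑ i, D i k ^ 2 := by
  by_cases h : (k' : ℕ) < dr
  · have hk' : (k : ℕ) < dr := lt_of_le_of_lt hk h
    have e : ∑ i, D i k' ^ 2 = D ⟨k', h⟩ k' ^ 2 :=
      Finset.sum_eq_single _ (fun i _ hi => by
        rw [hS.off_diagonal i k' fun he => hi (Fin.ext he)]; simp) (by simp)
    rw [e]
    calc D ⟨k', h⟩ k' ^ 2 ≤ D ⟨k, hk'⟩ k ^ 2 :=
          pow_le_pow_left₀ (hS.diagonal_nonneg _ _ rfl)
            (hS.diagonal_antitone ⟨k, hk'⟩ ⟨k', h⟩ k k' rfl rfl hk) 2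
      _ ≤ _ := Finset.single_le_sum (f := fun i => D i k ^ 2) (fun i _ => sq_nonneg _)
          (Finset.mem_univ _)
  · have : ∑ i, D i k' ^ 2 = 0 := Finset.sum_eq_zero fun i _ => by
      rw [hS.off_diagonal i k' fun he => h (he ▸ i.2)]; simp
    rw [this]; positivity

/-- Weyl's inequality at index `r` against a matrix `B` of rank at most `r`: the singular value of
`A` numbered `r` (from zero) is at most `‖A - B‖_F`. Some unit vector in the span of the first
`r + 1` right singular vectors is annihilated by `B`. -/
lemma sum_sq_column_le (hS : IsSVD A U D V) {B : Matrix (Fin dr) (Fin dc) ℝ} (k₀ : Fin dc)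
    (hB : B.rank ≤ k₀) : ∑ i, D i k₀ ^ 2 ≤ frobNorm (A - B) ^ 2 := by
  have hcard : B.rank < Fintype.card {k : Fin dc // (k : ℕ) < k₀ + 1} := by
    have : Function.Injective (fun i : Fin (k₀ + 1) =>
        (⟨⟨i, by omega⟩, i.2⟩ : {k : Fin dc // (k : ℕ) < k₀ + 1})) := fun a b hab => by
      simpa [Fin.ext_iff] using hab
    have := Fintype.card_le_of_injective _ this
    rw [Fintype.card_fin] at this
    omega
  obtain ⟨z', hz0, hz'⟩ := exists_mulVec_eq_zero_of_rank_lt (B * firstCols V (k₀ + 1))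
    ((Matrix.rank_mul_le_left _ _).trans_lt hcard)
  set z : Fin dc → ℝ := fun k => if hk : (k : ℕ) < k₀ + 1 then z' ⟨k, hk⟩ else 0 with hz
  have hzsupp : ∀ k : Fin dc, (k₀ : ℕ) + 1 ≤ k → z k = 0 := fun k hk => by
    simp only [hz, dif_neg (not_lt.2 hk)]
  have hVz : firstCols V (k₀ + 1) *ᵥ z' = V *ᵥ z :=
    firstCols_mulVec V _ z' z (fun k => by simp only [hz, dif_pos k.2]) hzsupp
  have hBz : B *ᵥ (V *ᵥ z) = 0 := by rw [← hVz, Matrix.mulVec_mulVec, hz']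
  have hVV : Vᵀ * V = 1 := by
    have := (Matrix.mem_orthogonalGroup_iff' (Fin dc) ℝ).1 hS.right_orthogonal
    simpa [Matrix.star_eq_conjTranspose] using this
  have hAz : (A - B) *ᵥ (V *ᵥ z) = U *ᵥ (D *ᵥ z) := by
    rw [Matrix.sub_mulVec, hBz, sub_zero, hS.eq_mul, Matrix.mulVec_mulVec, Matrix.mul_assoc, hVV,
      Matrix.mul_one, Matrix.mulVec_mulVec]
  have h1 := sum_sq_mulVec_le (A - B) (V *ᵥ z)
  rw [hAz, sum_sq_orthogonal_mulVec hS.left_orthogonal, hS.sum_sq_diagonal_mulVec,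
    sum_sq_orthogonal_mulVec hS.right_orthogonal] at h1
  have h2 : (∑ i, D i k₀ ^ 2) * ∑ k, z k ^ 2 ≤ ∑ k, (∑ i, D i k ^ 2) * z k ^ 2 := by
    rw [Finset.mul_sum]
    refine Finset.sum_le_sum fun k _ => ?_
    by_cases hk : (k : ℕ) < k₀ + 1
    · exact mul_le_mul_of_nonneg_right
        (hS.sum_sq_column_antitone (Fin.le_def.2 (by omega))) (sq_nonneg _)
    · simp [hzsupp k (not_lt.1 hk)]
  have h3 : 0 < ∑ k, z k ^ 2 := by
    obtain ⟨k, hk⟩ := Function.ne_iff.1 hz0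
    refine Finset.sum_pos' (fun _ _ => sq_nonneg _) ⟨k.1, Finset.mem_univ _, ?_⟩
    have : z k.1 = z' k := by simp only [hz, dif_pos k.2]
    rw [this]
    exact sq_pos_iff.2 hk
  exact le_of_mul_le_mul_right (h2.trans h1) h3

/-- Each row of a matrix `B` of rank at most `r` lies within `2 ‖A - B‖_F` of the span of the first
`r` right singular vectors of `A`. -/
lemma exists_firstCols_mulVec_near (hS : IsSVD A U D V) {B : Matrix (Fin dr) (Fin dc) ℝ} {r : ℕ}
    (hB : B.rank ≤ r) (j : Fin dr) :
    ∃ θ, ∑ k, ((firstCols V r *ᵥ θ) k - B j k) ^ 2 ≤ 4 * frobNorm (A - B) ^ 2 := by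
  set C := U * D with hC
  set u : Fin dc → ℝ := fun k => if (k : ℕ) < r then C j k else 0 with hu
  set w : Fin dc → ℝ := fun k => if (k : ℕ) < r then 0 else C j k with hw
  have hAj : A j = V *ᵥ u + V *ᵥ w := by
    rw [← Matrix.mulVec_add]
    have : u + w = C j := by
      ext k; simp only [hu, hw, Pi.add_apply]; split_ifs <;> simp
    rw [this, hS.eq_mul, ← hC]
    ext i
    simp [Matrix.mul_apply, mulVec, dotProduct, mul_comm]
  -- `‖w‖²` is the `j`-th entry of `U D w`, whose norm is at most the first discarded singular
  -- value times `‖w‖`.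
  have hw2 : ∑ k, w k ^ 2 ≤ frobNorm (A - B) ^ 2 := by
    have hCw : (∑ k, w k ^ 2) ^ 2 ≤ frobNorm (A - B) ^ 2 * ∑ k, w k ^ 2 := by
      have e1 : ∑ k, w k ^ 2 = (U *ᵥ (D *ᵥ w)) j := by
        rw [Matrix.mulVec_mulVec, ← hC, mulVec, dotProduct]
        refine Finset.sum_congr rfl fun k _ => ?_
        simp only [hw]; split_ifs <;> ring
      calc (∑ k, w k ^ 2) ^ 2 ≤ ∑ i, (U *ᵥ (D *ᵥ w)) i ^ 2 := by
            rw [e1]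
            exact Finset.single_le_sum (f := fun i => (U *ᵥ (D *ᵥ w)) i ^ 2)
              (fun i _ => sq_nonneg _) (Finset.mem_univ j)
        _ = ∑ k, (∑ i, D i k ^ 2) * w k ^ 2 := by
            rw [sum_sq_orthogonal_mulVec hS.left_orthogonal, hS.sum_sq_diagonal_mulVec]
        _ ≤ _ := by
            rw [Finset.mul_sum]
            refine Finset.sum_le_sum fun k _ => ?_
            by_cases hk : (k : ℕ) < r
            · simp [hw, hk]
            · exact mul_le_mul_of_nonneg_right
                (hS.sum_sq_column_le k (hB.trans (not_lt.1 hk))) (sq_nonneg _)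
    rcases (Finset.sum_nonneg fun k _ => sq_nonneg (w k) : 0 ≤ ∑ k, w k ^ 2).eq_or_lt with h0 | h0
    · rw [← h0]; positivity
    · rw [sq (∑ k, w k ^ 2)] at hCw
      exact le_of_mul_le_mul_right hCw h0
  refine ⟨fun k => C j k, ?_⟩
  rw [firstCols_mulVec V r _ u (fun k => by simp [hu, k.2])
    (fun k hk => by simp [hu, not_lt.2 hk])]
  calc ∑ k, ((V *ᵥ u) k - B j k) ^ 2
      ≤ ∑ k, (2 * (V *ᵥ w) k ^ 2 + 2 * (A - B) j k ^ 2) := by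
        refine Finset.sum_le_sum fun k _ => ?_
        have : (V *ᵥ u) k - B j k = (A - B) j k - (V *ᵥ w) k := by
          rw [Matrix.sub_apply, hAj, Pi.add_apply]; ring
        rw [this]
        nlinarith [sq_nonneg ((A - B) j k + (V *ᵥ w) k)]
    _ = 2 * ∑ k, w k ^ 2 + 2 * ∑ k, (A - B) j k ^ 2 := by
        rw [Finset.sum_add_distrib, ← Finset.mul_sum, ← Finset.mul_sum,
          sum_sq_orthogonal_mulVec hS.right_orthogonal]
    _ ≤ 2 * frobNorm (A - B) ^ 2 + 2 * frobNorm (A - B) ^ 2 := by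
        gcongr
        rw [sq_frobNorm]
        exact Finset.single_le_sum (f := fun j => ∑ k, (A - B) j k ^ 2)
          (fun i _ => Finset.sum_nonneg fun k _ => sq_nonneg _) (Finset.mem_univ j)
    _ = _ := by ring

end IsSVD

/-! ### Least squares on one row -/

/-- Stability of least squares with `N k` observations of entry `k` and noise sums `Z k`: if the
loss at error vector `e` is at most the loss at `b`, a small `b` forces a small `e`. -/
lemma sum_sq_error_le {N Z e b : Fin dc → ℝ} {n κ H : ℝ} (hn : 0 < n) (hκ : 0 < κ) (hκ1 : κ ≤ 1)
    (hH : 0 < H)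
    (hloss : ∑ k, (N k * e k ^ 2 - 2 * Z k * e k) ≤ ∑ k, (N k * b k ^ 2 - 2 * Z k * b k))
    (hNl : ∀ k, κ * n ≤ N k) (hNu : ∀ k, N k ≤ n) (hZ : ∀ k, dc * |Z k| ≤ κ * H / 8 * n)
    (hb : ∑ k, b k ^ 2 ≤ (κ * H / 4) ^ 2) : ∑ k, e k ^ 2 ≤ H ^ 2 := by
  have key : ∀ v : Fin dc → ℝ, |∑ k, 2 * Z k * v k| ≤ κ * H / 4 * n * √(∑ k, v k ^ 2) := by
    intro v
    rcases Nat.eq_zero_or_pos dc with rfl | hdc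
    · simp
    have hdc' : (0 : ℝ) < dc := by exact_mod_cast hdc
    calc |∑ k, 2 * Z k * v k| ≤ ∑ k, |2 * Z k * v k| := Finset.abs_sum_le_sum_abs _ _
      _ ≤ ∑ _k : Fin dc, κ * H / 4 * n / dc * √(∑ k, v k ^ 2) := by
          refine Finset.sum_le_sum fun k _ => ?_
          rw [abs_mul, abs_mul, abs_two]
          have h1 : |v k| ≤ √(∑ k, v k ^ 2) := Real.abs_le_sqrt
            (Finset.single_le_sum (f := fun k => v k ^ 2) (fun _ _ => sq_nonneg _)
              (Finset.mem_univ k))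
          have h2 : 2 * |Z k| ≤ κ * H / 4 * n / dc := by
            rw [le_div_iff₀ hdc']
            linarith [hZ k]
          exact mul_le_mul h2 h1 (abs_nonneg _) (by positivity)
      _ = _ := by
          rw [Finset.sum_const, Finset.card_univ, Fintype.card_fin, nsmul_eq_mul]
          field_simp
  -- Otherwise the quadratic term `κ ‖e‖²` exceeds all the other terms of the loss comparison.
  by_contra! hcon
  set x := √(∑ k, e k ^ 2) with hx
  set β := √(∑ k, b k ^ 2) with hβ
  have hx2 : x ^ 2 = ∑ k, e k ^ 2 := Real.sq_sqrt (by positivity)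
  have hβ2 : β ^ 2 = ∑ k, b k ^ 2 := Real.sq_sqrt (by positivity)
  have hxH : H < x := (Real.lt_sqrt hH.le).2 hcon
  have hβH : β ≤ κ * H / 4 := (Real.sqrt_le_left (by positivity)).2 hb
  have hβ0 : 0 ≤ β := Real.sqrt_nonneg _
  have h1 : κ * n * x ^ 2 ≤ ∑ k, N k * e k ^ 2 := by
    rw [hx2, Finset.mul_sum]
    exact Finset.sum_le_sum fun k _ => mul_le_mul_of_nonneg_right (hNl k) (sq_nonneg _)
  have h2 : ∑ k, N k * b k ^ 2 ≤ n * β ^ 2 := by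
    rw [hβ2, Finset.mul_sum]
    exact Finset.sum_le_sum fun k _ => mul_le_mul_of_nonneg_right (hNu k) (sq_nonneg _)
  rw [Finset.sum_sub_distrib, Finset.sum_sub_distrib] at hloss
  have h3 := (abs_le.1 (key e)).2
  have h4 := (abs_le.1 (key b)).1
  have h5 : n * (κ * x ^ 2) ≤ n * (β ^ 2 + κ * H / 4 * β + κ * H / 4 * x) := by
    rw [← hx] at h3
    rw [← hβ] at h4
    nlinarith
  have h6 := le_of_mul_le_mul_left h5 hn
  have hκH : 0 < κ * H := mul_pos hκ hH
  have hHx : κ * H ≤ κ * x := mul_le_mul_of_nonneg_left hxH.le hκ.le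
  have h7 : κ * H / 4 * x ≤ κ * x ^ 2 / 4 := by nlinarith
  have hβx : β ≤ x / 4 := by nlinarith
  have h8 : κ * H / 4 * β ≤ κ * x ^ 2 / 16 := by nlinarith
  have h9 : β ^ 2 ≤ κ * x ^ 2 / 16 := by nlinarith
  nlinarith [mul_pos hκ (pow_pos (hH.trans hxH) 2)]

/-- A least-squares fit on row `j` has error at most `H`, provided every entry of the row is
observed a positive fraction `κ` of the time, the noise sums are small, and some coefficient vector
has small bias. -/
lemma sum_sq_leastSquares_error_le {ι : Type} [Fintype ι] (W : Matrix (Fin dc) ι ℝ)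
    (arm : ℕ → Fin dr × Fin dc) (B : Matrix (Fin dr) (Fin dc) ℝ) (ε : ℕ → ℝ) (J : Finset ℕ)
    (j : Fin dr) (θ θ₀ : ι → ℝ) {κ H : ℝ} (hJ : 0 < J.card) (hκ : 0 < κ) (hκ1 : κ ≤ 1) (hH : 0 < H)
    (hmin : rowLoss W arm (fun s => B (arm s).1 (arm s).2 + ε s) J j θ ≤
      rowLoss W arm (fun s => B (arm s).1 (arm s).2 + ε s) J j θ₀)
    (hcount : ∀ k, κ * J.card ≤ ∑ s ∈ J, if arm s = (j, k) then (1 : ℝ) else 0)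
    (hnoise : ∀ k, dc * |∑ s ∈ J, if arm s = (j, k) then ε s else 0| ≤ κ * H / 8 * J.card)
    (hbias : ∑ k, ((W *ᵥ θ₀) k - B j k) ^ 2 ≤ (κ * H / 4) ^ 2) :
    ∑ k, ((W *ᵥ θ) k - B j k) ^ 2 ≤ H ^ 2 := by
  set N : Fin dc → ℝ := fun k => ∑ s ∈ J, if arm s = (j, k) then (1 : ℝ) else 0 with hN
  set Z : Fin dc → ℝ := fun k => ∑ s ∈ J, if arm s = (j, k) then ε s else 0 with hZ
  -- Sorting the observations by column; the pure noise term does not depend on `v`.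
  have hexp : ∀ v : ι → ℝ, rowLoss W arm (fun s => B (arm s).1 (arm s).2 + ε s) J j v =
      ∑ s ∈ J with (arm s).1 = j, ε s ^ 2 +
        ∑ k, (N k * ((W *ᵥ v) k - B j k) ^ 2 - 2 * Z k * ((W *ᵥ v) k - B j k)) := by
    intro v
    have e2 : ∑ k, (N k * ((W *ᵥ v) k - B j k) ^ 2 - 2 * Z k * ((W *ᵥ v) k - B j k)) =
        ∑ s ∈ J with (arm s).1 = j, (((W *ᵥ v) (arm s).2 - B j (arm s).2) ^ 2
          - 2 * ε s * ((W *ᵥ v) (arm s).2 - B j (arm s).2)) := by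
      simp only [hN, hZ, Finset.mul_sum, Finset.sum_mul]
      simp_rw [← Finset.sum_sub_distrib]
      rw [Finset.sum_comm, Finset.sum_filter]
      refine Finset.sum_congr rfl fun s _ => ?_
      split_ifs with hs
      · rw [Finset.sum_eq_single (arm s).2 _ (by simp)]
        · have : arm s = (j, (arm s).2) := Prod.ext hs rfl
          rw [if_pos this, if_pos this]; ring
        · intro k _ hk
          have : arm s ≠ (j, k) := fun h => hk (by rw [h])
          rw [if_neg this, if_neg this]; ring
      · refine Finset.sum_eq_zero fun k _ => ?_
        have : arm s ≠ (j, k) := fun h => hs (by rw [h])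
        rw [if_neg this, if_neg this]; ring
    rw [e2, ← Finset.sum_add_distrib]
    refine Finset.sum_congr rfl fun s hs => ?_
    have hs' : B (arm s).1 (arm s).2 = B j (arm s).2 := by rw [(Finset.mem_filter.1 hs).2]
    dsimp only
    rw [hs']
    ring
  rw [hexp, hexp] at hmin
  refine sum_sq_error_le (n := J.card) (N := N) (Z := Z) (by exact_mod_cast hJ) hκ hκ1 hH
    (le_of_add_le_add_left hmin) hcount (fun k => ?_) hnoise hbias
  calc N k ≤ ∑ s ∈ J, (1 : ℝ) := Finset.sum_le_sum fun s _ => by split_ifs <;> norm_num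
    _ = _ := by simp

/-! ### Independence of the rounds -/

/-- If two families of random variables are jointly independent, the pairs formed index by index
are independent. -/
lemma iIndepFun_prodMk_of_sum {Ω α β : Type*} {ι : Type} [MeasurableSpace Ω] {μ : Measure Ω}
    [MeasurableSpace α] [MeasurableSpace β] {f : ι → Ω → α} {g : ι → Ω → β}
    (hf : ∀ s, Measurable (f s)) (hg : ∀ s, Measurable (g s))
    (h : iIndep (Sum.elim (fun s : ι => MeasurableSpace.comap (f s) inferInstance)
      (fun s : ι => MeasurableSpace.comap (g s) inferInstance)) μ) :
    iIndepFun (fun s ω => (f s ω, g s ω)) μ := by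
  refine iIndepSets.iIndep (fun s => ((hf s).prodMk (hg s)).comap_le)
    (fun s => Set.preimage (fun ω => (f s ω, g s ω)) ''
      Set.image2 (· ×ˢ ·) {t : Set α | MeasurableSet t} {t : Set β | MeasurableSet t})
    (fun s => ?_) (fun s => ?_) ?_
  · have := (isPiSystem_prod (α := α) (β := β)).comap (fun ω => (f s ω, g s ω))
    convert! this using 1
  · rw [← MeasurableSpace.comap_generateFrom, generateFrom_prod]
  · rw [iIndepSets_iff]
    intro S F hF
    have hF' : ∀ s ∈ S, ∃ A : Set α, ∃ B : Set β, MeasurableSet A ∧ MeasurableSet B ∧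
        F s = f s ⁻¹' A ∩ g s ⁻¹' B := by
      intro s hs
      obtain ⟨_, ⟨A, hA, B, hB, rfl⟩, hFs⟩ := hF s hs
      exact ⟨A, B, hA, hB, by rw [← hFs]; rfl⟩
    choose! A B hA hB hAB using hF'
    have hmeas : ∀ T : Finset (ι ⊕ ι), (∀ i ∈ T, Sum.elim id id i ∈ S) →
        μ (⋂ i ∈ T, Sum.elim (fun s => f s ⁻¹' A s) (fun s => g s ⁻¹' B s) i) =
        ∏ i ∈ T, μ (Sum.elim (fun s => f s ⁻¹' A s) (fun s => g s ⁻¹' B s) i) := by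
      intro T hT
      refine h.meas_biInter fun i hi => ?_
      have := hT i hi
      rcases i with s | s
      · exact ⟨A s, hA s this, rfl⟩
      · exact ⟨B s, hB s this, rfl⟩
    have h1 := hmeas (S.disjSum S) (by simp)
    have h2 : ∀ s ∈ S, μ (F s) = μ (f s ⁻¹' A s) * μ (g s ⁻¹' B s) := by
      classical
      intro s hs
      have := hmeas {Sum.inl s, Sum.inr s} (by simp [hs])
      rw [Finset.prod_pair (by simp)] at this
      rw [hAB s hs]
      simpa using this
    rw [Finset.prod_congr rfl h2, Finset.prod_mul_distrib]
    rw [Finset.prod_disjSum] at h1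
    simp only [Sum.elim_inl, Sum.elim_inr] at h1
    rw [← h1]
    congr 1
    ext ω
    simp only [Set.mem_iInter, Finset.mem_disjSum, Sum.forall]
    constructor
    · intro hω
      refine ⟨fun s hs => ?_, fun s hs => ?_⟩
      · have hs' : s ∈ S := by simpa using hs
        have := hω s hs'
        rw [hAB s hs'] at this
        exact this.1
      · have hs' : s ∈ S := by simpa using hs
        have := hω s hs'
        rw [hAB s hs'] at this
        exact this.2
    · rintro ⟨hω1, hω2⟩ s hs
      rw [hAB s hs]
      exact ⟨hω1 s (by simpa using hs), hω2 s (by simpa using hs)⟩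

/-! ### Concentration on uniformly sampled entries -/

/-- A sub-Gaussian noise that is only recorded when an independent position equals `a` is
sub-Gaussian with the same parameter. -/
lemma hasSubgaussianMGF_ite_of_prod {P : Type*} [MeasurableSpace P] [MeasurableSingletonClass P]
    [DecidableEq P] (π : Measure P) [IsProbabilityMeasure π] (m : Measure ℝ)
    [IsProbabilityMeasure m] (hm : HasSubgaussianMGF id 1 m) (a : P) :
    HasSubgaussianMGF (fun z : P × ℝ => if z.1 = a then z.2 else 0) 1 (π.prod m) := by
  have hmeas : Measurable (fun z : P × ℝ => if z.1 = a then z.2 else 0) :=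
    Measurable.ite (measurable_fst (measurableSet_singleton a)) measurable_snd measurable_const
  have hint : ∀ t : ℝ, Integrable
      (fun z : P × ℝ => Real.exp (t * if z.1 = a then z.2 else 0)) (π.prod m) := by
    intro t
    have h1 : Integrable (fun z : P × ℝ => Real.exp (t * z.2) + 1) (π.prod m) :=
      ((hm.integrable_exp_mul t).comp_snd π).add (integrable_const 1)
    refine h1.mono' (by fun_prop) (ae_of_all _ fun z => ?_)
    rw [Real.norm_eq_abs, Real.abs_exp]
    split_ifs
    · linarith
    · simp [(Real.exp_pos _).le]
  refine ⟨hint, fun t => ?_⟩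
  rw [mgf, integral_prod _ (hint t)]
  have hle : ∀ x : P, ∫ y, Real.exp (t * if x = a then y else 0) ∂m
      ≤ Real.exp (((1 : NNReal) : ℝ) * t ^ 2 / 2) := by
    intro x
    split_ifs
    · exact hm.mgf_le t
    · simp only [mul_zero, Real.exp_zero, integral_const, probReal_univ, smul_eq_mul, mul_one]
      exact Real.one_le_exp (by positivity)
  calc _ ≤ ∫ _x : P, Real.exp (((1 : NNReal) : ℝ) * t ^ 2 / 2) ∂π :=
        integral_mono (hint t).integral_prod_left (integrable_const _) hle
    _ = _ := by simp

section Concentration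

variable {Ω : Type*} [MeasurableSpace Ω] {ν : Measure Ω} {P : Type*} [MeasurableSpace P]
  [MeasurableSingletonClass P] [DecidableEq P] [Fintype P] [Nonempty P] {ι : Type} [Fintype ι]
  {X : ι → Ω → P × ℝ} {m : ι → Measure ℝ}

/-- The sum of the noises recorded at a given position has sub-Gaussian tails governed by the total
number of samples. -/
lemma measureReal_abs_noise_sum_ge_le (hX : ∀ i, Measurable (X i)) (hind : iIndepFun X ν)
    (hm : ∀ i, IsProbabilityMeasure (m i))
    (hlaw : ∀ i, ν.map (X i) = (uniformOn (Set.univ : Set P)).prod (m i))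
    (hsub : ∀ i, HasSubgaussianMGF id 1 (m i)) (a : P) {η : ℝ} (hη : 0 ≤ η) :
    ν.real {ω | η * Fintype.card ι ≤ |∑ i, if (X i ω).1 = a then (X i ω).2 else 0|} ≤
      2 * Real.exp (-(η ^ 2 * Fintype.card ι / 2)) := by
  have := hind.isProbabilityMeasure
  set g : P × ℝ → ℝ := fun z => if z.1 = a then z.2 else 0 with hg
  have hgm : Measurable g :=
    Measurable.ite (measurable_fst (measurableSet_singleton a)) measurable_snd measurable_const
  have hgi : iIndepFun (fun i => g ∘ X i) ν := hind.comp (fun _ => g) fun _ => hgm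
  have hgs : ∀ i, HasSubgaussianMGF (g ∘ X i) 1 ν := fun i =>
    HasSubgaussianMGF.of_map (hX i).aemeasurable
      (by rw [hlaw i]; exact hasSubgaussianMGF_ite_of_prod _ _ (hsub i) a)
  have hsum := HasSubgaussianMGF.sum_of_iIndepFun hgi (c := fun _ => 1) (s := Finset.univ)
    fun i _ => hgs i
  have hexp : Real.exp (-(η * Fintype.card ι) ^ 2 / (2 * ((∑ _i : ι, (1 : NNReal) : NNReal) : ℝ)))
      ≤ Real.exp (-(η ^ 2 * Fintype.card ι / 2)) := by
    refine Real.exp_le_exp.2 (le_of_eq ?_)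
    rcases eq_or_ne (Fintype.card ι : ℝ) 0 with h0 | h0
    · simp [h0]
    · simp; field_simp
  have h1 := (hsum.measure_ge_le (ε := η * Fintype.card ι) (by positivity)).trans hexp
  have h2 := (hsum.neg.measure_ge_le (ε := η * Fintype.card ι) (by positivity)).trans hexp
  have hsub' : {ω | η * Fintype.card ι ≤ |∑ i, if (X i ω).1 = a then (X i ω).2 else 0|} ⊆
      {ω | η * Fintype.card ι ≤ ∑ i, (g ∘ X i) ω} ∪
        {ω | η * Fintype.card ι ≤ (-fun ω => ∑ i, (g ∘ X i) ω) ω} := by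
    intro ω hω
    rw [Set.mem_ofPred_eq] at hω
    rcases le_abs.1 hω with h | h
    · exact Or.inl h
    · exact Or.inr h
  calc _ ≤ _ := measureReal_mono hsub'
    _ ≤ _ := measureReal_union_le _ _
    _ ≤ _ := by linarith

/-- With exponentially high probability a given position receives at least half of its expected
number of the uniform samples. -/
lemma measureReal_count_le (hX : ∀ i, Measurable (X i)) (hind : iIndepFun X ν)
    (hm : ∀ i, IsProbabilityMeasure (m i))
    (hlaw : ∀ i, ν.map (X i) = (uniformOn (Set.univ : Set P)).prod (m i)) (a : P) {κ : ℝ}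
    (hκ : κ * (2 * Fintype.card P) = 1) :
    ν.real {ω | ∑ i, (if (X i ω).1 = a then (1 : ℝ) else 0) ≤ κ * Fintype.card ι} ≤
      Real.exp (-(2 * κ ^ 2 * Fintype.card ι)) := by
  have := hind.isProbabilityMeasure
  have hcard : (0 : ℝ) < Fintype.card P := by exact_mod_cast Fintype.card_pos
  -- `2 κ` is the probability of the position `a`, so `g` is centred.
  set g : P × ℝ → ℝ := fun z => 2 * κ - (if z.1 = a then 1 else 0) with hg
  have hgm : Measurable g := measurable_const.sub
    (Measurable.ite (measurable_fst (measurableSet_singleton a)) measurable_const measurable_const)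
  have hgi : iIndepFun (fun i => g ∘ X i) ν := hind.comp (fun _ => g) fun _ => hgm
  have hgs : ∀ i, HasSubgaussianMGF (g ∘ X i) ((‖2 * κ - (2 * κ - 1)‖₊ / 2) ^ 2) ν := by
    intro i
    refine HasSubgaussianMGF.of_map (hX i).aemeasurable ?_
    rw [hlaw i]
    refine hasSubgaussianMGF_of_mem_Icc_of_integral_eq_zero hgm.aemeasurable
      (ae_of_all _ fun z => ?_) ?_
    · simp only [hg, Set.mem_Icc]; split_ifs <;> constructor <;> linarith
    · have e : (fun z : P × ℝ => (if z.1 = a then (1 : ℝ) else 0)) =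
          ({a} ×ˢ Set.univ : Set (P × ℝ)).indicator 1 := by
        ext z; simp [Set.indicator_apply]
      have hms : MeasurableSet ({a} ×ˢ Set.univ : Set (P × ℝ)) :=
        (measurableSet_singleton a).prod MeasurableSet.univ
      simp only [hg]
      rw [integral_sub (integrable_const _)
        (by rw [e]; exact (integrable_const (1 : ℝ)).indicator hms), e, integral_indicator_one hms]
      simp only [integral_const, smul_eq_mul, measureReal_def,
        Measure.prod_prod, measure_univ, mul_one, uniformOn_univ, Measure.count_singleton]
      rw [ENNReal.toReal_div, ENNReal.toReal_one, ENNReal.toReal_natCast, sub_eq_zero,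
        eq_div_iff hcard.ne']
      linarith
  have hκ0 : 0 < κ := by
    by_contra hc
    have := mul_nonpos_of_nonpos_of_nonneg (not_lt.1 hc)
      (by positivity : 0 ≤ 2 * (Fintype.card P : ℝ))
    linarith
  have hsum := (HasSubgaussianMGF.sum_of_iIndepFun hgi
    (c := fun _ => (‖2 * κ - (2 * κ - 1)‖₊ / 2) ^ 2) (s := Finset.univ)
    fun i _ => hgs i).measure_ge_le (ε := κ * Fintype.card ι) (by positivity)
  have hset : {ω | ∑ i, (if (X i ω).1 = a then (1 : ℝ) else 0) ≤ κ * Fintype.card ι} =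
      {ω | κ * Fintype.card ι ≤ ∑ i, (g ∘ X i) ω} := by
    ext ω
    simp only [Set.mem_ofPred_eq, hg, Function.comp_apply, Finset.sum_sub_distrib, Finset.sum_const,
      Finset.card_univ, nsmul_eq_mul]
    constructor <;> intro h <;> linarith
  rw [hset]
  refine hsum.trans (Real.exp_le_exp.2 (le_of_eq ?_))
  have e1 : (2 * κ - (2 * κ - 1) : ℝ) = 1 := by ring
  rw [e1]
  rcases eq_or_ne (Fintype.card ι : ℝ) 0 with h0 | h0
  · simp [h0]
  · simp; field_simp

end Concentration

/-! ### The number of forced rounds -/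

/-- Lower Chernoff bound for the number of independent events that occur. -/
lemma measureReal_sum_indicator_le {Ω : Type*} [MeasurableSpace Ω] {μ : Measure Ω} {ι : Type}
    {Y : ι → Ω → ℝ} (hY : ∀ i, Measurable (Y i)) (hind : iIndepFun Y μ)
    (h01 : ∀ i ω, Y i ω = 0 ∨ Y i ω = 1) (T : Finset ι) (c : ℝ) :
    μ.real {ω | ∑ i ∈ T, Y i ω ≤ c} ≤ Real.exp (c - (∑ i ∈ T, μ[Y i]) / 2) := by
  have := hind.isProbabilityMeasure
  have hbd : ∀ i, Integrable (Y i) μ := fun i =>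
    (integrable_const (1 : ℝ)).mono' (hY i).aestronglyMeasurable
      (ae_of_all _ fun ω => by rcases h01 i ω with h | h <;> simp [h])
  have hexp1 : Real.exp (-1) ≤ 1 / 2 := by
    rw [Real.exp_neg, inv_eq_one_div]
    have := Real.add_one_le_exp 1
    exact one_div_le_one_div_of_le two_pos (by linarith)
  have hm : ∀ i, mgf (Y i) μ (-1) ≤ Real.exp (-(μ[Y i]) / 2) := by
    intro i
    have e : ∀ ω, Real.exp (-1 * Y i ω) ≤ 1 - Y i ω / 2 := fun ω => by
      rcases h01 i ω with h | h
      · simp [h]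
      · rw [h, mul_one]; linarith
    have e' : Integrable (fun ω => Real.exp (-1 * Y i ω)) μ :=
      (integrable_const (1 : ℝ)).mono' (by fun_prop) (ae_of_all _ fun ω => by
        rw [Real.norm_eq_abs, Real.abs_exp]
        refine Real.exp_le_one_iff.2 ?_
        rcases h01 i ω with h | h <;> simp [h])
    calc mgf (Y i) μ (-1) ≤ ∫ ω, (1 - Y i ω / 2) ∂μ :=
          integral_mono e' ((integrable_const _).sub ((hbd i).div_const 2)) e
      _ = 1 - μ[Y i] / 2 := by
          rw [integral_sub (integrable_const _) ((hbd i).div_const 2), integral_div]; simp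
      _ ≤ _ := by
          have := Real.add_one_le_exp (-(μ[Y i]) / 2)
          linarith
  have hint : Integrable (fun ω => Real.exp (-1 * (∑ i ∈ T, Y i) ω)) μ := by
    refine (integrable_const (1 : ℝ)).mono' (by fun_prop) (ae_of_all _ fun ω => ?_)
    rw [Real.norm_eq_abs, Real.abs_exp]
    refine Real.exp_le_one_iff.2 ?_
    have : 0 ≤ (∑ i ∈ T, Y i) ω := by
      rw [Finset.sum_apply]
      exact Finset.sum_nonneg fun i _ => by rcases h01 i ω with h | h <;> simp [h]
    linarith
  have h := measure_le_le_exp_mul_mgf (X := ∑ i ∈ T, Y i) c (by norm_num : (-1 : ℝ) ≤ 0) hint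
  rw [hind.mgf_sum hY] at h
  simp only [Finset.sum_apply] at h
  refine h.trans ?_
  calc Real.exp (- -1 * c) * ∏ i ∈ T, mgf (Y i) μ (-1)
      ≤ Real.exp (- -1 * c) * ∏ i ∈ T, Real.exp (-(μ[Y i]) / 2) := by
        gcongr with i _
        · exact fun i _ => mgf_nonneg
        · exact hm i
    _ = _ := by
        rw [← Real.exp_sum, ← Real.exp_add, ← Finset.sum_div, Finset.sum_neg_distrib]
        congr 1; ring

/-- The expected number of forced rounds up to time `t` is at least `ρ log t / 2`. The first
`2 ρ log ρ` rounds are all forced, and later `∑ ρ / (s + 1)` is bounded below by telescoping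
logarithms. -/
lemma le_sum_forcedProb {dr dc : ℕ} (hdr : 0 < dr) (hdc : 0 < dc) {ρ : ℝ} (hρ : 32 ≤ ρ) {t : ℕ}
    (ht : 2 * ρ * Real.log ρ ≤ t) :
    ρ * Real.log t / 2 ≤ ∑ s ∈ Finset.Icc 1 t, (dr * dc : ℝ) * forcedProb dr dc ρ s := by
  have hd1 : (0 : ℝ) < dr := by exact_mod_cast hdr
  have hd2 : (0 : ℝ) < dc := by exact_mod_cast hdc
  have hρ0 : 0 < ρ := by linarith
  have hlog : 1 ≤ Real.log ρ := by
    rw [Real.le_log_iff_exp_le hρ0]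
    have := Real.exp_one_lt_d9
    linarith
  have hρlog : 32 ≤ ρ * Real.log ρ := by nlinarith
  have hcell : ∀ s : ℕ, (2 * ρ * Real.log ρ < s) →
      ρ / (s + 1) ≤ (dr * dc : ℝ) * forcedProb dr dc ρ s := by
    intro s hs
    unfold forcedProb
    rw [if_neg (not_le.2 hs)]
    have hpos : 0 < (s : ℝ) - ρ * Real.log ρ + 1 := by linarith
    have e : (dr * dc : ℝ) * (ρ / (dr * dc * (s - ρ * Real.log ρ + 1))) =
        ρ / (s - ρ * Real.log ρ + 1) := by field_simp
    rw [e]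
    gcongr
    linarith
  set a := ⌊2 * ρ * Real.log ρ⌋₊ with ha
  have ha1 : (a : ℝ) ≤ 2 * ρ * Real.log ρ := Nat.floor_le (by positivity)
  have ha2 : 2 * ρ * Real.log ρ < a + 1 := Nat.lt_floor_add_one _
  have hat : a ≤ t := Nat.floor_le_of_le ht
  have hmain : ∀ n, a ≤ n → (a : ℝ) + ρ * (Real.log (n + 2) - Real.log (a + 2)) ≤
      ∑ s ∈ Finset.Icc 1 n, (dr * dc : ℝ) * forcedProb dr dc ρ s := by
    intro n hn
    induction n, hn using Nat.le_induction with
    | base =>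
      have : ∑ s ∈ Finset.Icc 1 a, (dr * dc : ℝ) * forcedProb dr dc ρ s =
          ∑ s ∈ Finset.Icc 1 a, (1 : ℝ) := by
        refine Finset.sum_congr rfl fun s hs => ?_
        have hsa : (s : ℝ) ≤ a := by exact_mod_cast (Finset.mem_Icc.1 hs).2
        unfold forcedProb
        rw [if_pos (hsa.trans ha1)]
        field_simp
      rw [this]; simp
    | succ n hn ih =>
      rw [Finset.sum_Icc_succ_top (by omega)]
      have hn' : (a : ℝ) ≤ n := by exact_mod_cast hn
      have h1 := hcell (n + 1) (by push_cast; linarith)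
      have hn0 : (0 : ℝ) ≤ n := Nat.cast_nonneg n
      have h2 : Real.log ((n : ℝ) + 3) - Real.log (n + 2) ≤ 1 / (n + 2) := by
        rw [← Real.log_div (by positivity) (by positivity)]
        have := Real.log_le_sub_one_of_pos (x := ((n : ℝ) + 3) / (n + 2)) (by positivity)
        refine this.trans (le_of_eq ?_)
        field_simp; ring
      have h3 := mul_le_mul_of_nonneg_left h2 hρ0.le
      push_cast at h1 ⊢
      have e1 : ρ / ((n : ℝ) + 1 + 1) = ρ * (1 / (n + 2)) := by
        rw [mul_one_div]; congr 1; ring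
      have e2 : (n : ℝ) + 1 + 2 = n + 3 := by ring
      rw [e1] at h1
      rw [e2]
      linarith
  have h1 := hmain t hat
  have ht0 : (64 : ℝ) ≤ t := by linarith
  have h2 : Real.log t ≤ Real.log ((t : ℝ) + 2) :=
    Real.log_le_log (by linarith) (by linarith)
  have h3 : Real.log ((a : ℝ) + 2) ≤ 2 * Real.log ρ := by
    have e : 2 * Real.log ρ = Real.log (ρ ^ 2) := by rw [Real.log_pow]; norm_num
    rw [e]
    refine Real.log_le_log (by positivity) ?_
    -- The tangent line of `log` at `32`, with `log 32 = 5 log 2 < 7 / 2`.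
    have h4 : Real.log ρ ≤ ρ / 32 + 5 / 2 := by
      have h5 := Real.log_le_sub_one_of_pos (x := ρ / 32) (by positivity)
      rw [Real.log_div hρ0.ne' (by norm_num)] at h5
      have h6 : Real.log 32 = 5 * Real.log 2 := by
        rw [show (32 : ℝ) = 2 ^ 5 by norm_num, Real.log_pow]; norm_num
      have := Real.log_two_lt_d9
      linarith
    nlinarith
  have h4 : 1 ≤ Real.log t := by
    rw [Real.le_log_iff_exp_le (by linarith)]
    have := Real.exp_one_lt_d9
    linarith
  have h5 : ρ * (Real.log t - 2 * Real.log ρ) ≤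
      ρ * (Real.log ((t : ℝ) + 2) - Real.log (a + 2)) :=
    mul_le_mul_of_nonneg_left (by linarith) hρ0.le
  nlinarith

/-! ### Conditioning on the set of forced rounds -/

lemma measurableSet_isSome {Ω P : Type*} [MeasurableSpace Ω] [Fintype P] {F : Ω → Option P}
    (hF : ∀ a, MeasurableSet {ω | F ω = a}) :
    MeasurableSet {ω | (F ω).isSome = true} := by
  have hE : {ω | (F ω).isSome = true} = ⋃ a, {ω | F ω = some a} := by
    ext ω; simp [Option.isSome_iff_exists]
  rw [hE]
  exact MeasurableSet.iUnion fun a => hF _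

lemma measureReal_isSome {Ω P : Type*} [MeasurableSpace Ω] [Fintype P] {μ : Measure Ω}
    [IsProbabilityMeasure μ] {F : Ω → Option P} (hF : ∀ a, MeasurableSet {ω | F ω = a}) {p : ℝ}
    (hp : ∀ a, μ.real {ω | F ω = some a} = p) :
    μ.real {ω | (F ω).isSome = true} = Fintype.card P * p := by
  have hE : {ω | (F ω).isSome = true} = ⋃ a, {ω | F ω = some a} := by
    ext ω; simp [Option.isSome_iff_exists]
  rw [hE, measureReal_iUnion_fintype _ fun a => hF _]
  · simp [hp]
  · intro a b hab
    refine Set.disjoint_left.2 fun ω h1 h2 => hab ?_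
    rw [Set.mem_ofPred_eq] at h1 h2
    exact Option.some_injective _ (h1.symm.trans h2)

section Conditioning

variable {Ω : Type*} [MeasurableSpace Ω] {μ : Measure Ω} {P : Type*} [Fintype P]
  [MeasurableSpace P] [MeasurableSingletonClass P] {f : ℕ → Ω → Option P} {ε : ℕ → Ω → ℝ}

/-- Given that a position is drawn at all, it is uniform if all positions are equally likely. -/
lemma cond_isSome_eq_uniformOn [IsProbabilityMeasure μ] {F : Ω → Option P}
    (hF : ∀ a, MeasurableSet {ω | F ω = a}) {p : ℝ} (hp : ∀ a, μ.real {ω | F ω = some a} = p)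
    (h0 : μ {ω | (F ω).isSome = true} ≠ 0) (a₀ : P) (B : Set P) :
    μ[{ω | (F ω).getD a₀ ∈ B} | {ω | (F ω).isSome = true}] = uniformOn Set.univ B := by
  have hEm := measurableSet_isSome hF
  have hpos : Measurable fun ω => (F ω).getD a₀ := by
    refine measurable_to_countable' fun a => ?_
    have : (fun ω => (F ω).getD a₀) ⁻¹' {a} =
        ⋃ b ∈ {b : Option P | b.getD a₀ = a}, {ω | F ω = b} := by
      ext ω; simp
    rw [this]
    exact MeasurableSet.biUnion (Set.to_countable _) fun b _ => hF b
  have hq : ∀ a, μ {ω | F ω = some a} = ENNReal.ofReal p := fun a => by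
    rw [← hp a, ofReal_measureReal]
  have hμE : μ {ω | (F ω).isSome = true} = Fintype.card P * ENNReal.ofReal p := by
    rw [← ofReal_measureReal (μ := μ), measureReal_isSome hF hp,
      ENNReal.ofReal_mul (Nat.cast_nonneg _), ENNReal.ofReal_natCast]
  have hlaw : (μ[|{ω | (F ω).isSome = true}]).map (fun ω => (F ω).getD a₀) =
      uniformOn Set.univ := by
    refine Measure.ext_of_singleton fun a => ?_
    rw [Measure.map_apply hpos (measurableSet_singleton a), cond_apply hEm, uniformOn_univ,
      Measure.count_singleton]
    have : {ω | (F ω).isSome = true} ∩ (fun ω => (F ω).getD a₀) ⁻¹' {a} = {ω | F ω = some a} := by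
      ext ω
      rcases hω : F ω with _ | b <;> simp [hω]
    rw [this, hq, hμE]
    rw [hμE] at h0
    rw [ENNReal.mul_inv (Or.inr ENNReal.ofReal_ne_top) (Or.inl (ENNReal.natCast_ne_top _)),
      mul_assoc, ENNReal.inv_mul_cancel (right_ne_zero_of_mul h0) ENNReal.ofReal_ne_top, mul_one,
      one_div]
  rw [← hlaw, Measure.map_apply hpos (Set.toFinite B).measurableSet]
  rfl

/-- Conditionally on the set `S` of rounds (among those in `T`) at which a position is drawn, the
rounds stay independent, and in the rounds of `S` the position is uniform and independent of the
noise, whose law is unchanged. -/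
lemma cond_rounds [IsProbabilityMeasure μ] (hf : ∀ s a, MeasurableSet {ω | f s ω = a})
    (hε : ∀ s, Measurable (ε s))
    (hind : iIndep (Sum.elim (fun s : ℕ => MeasurableSpace.comap (f s) ⊤)
          (fun s : ℕ => MeasurableSpace.comap (ε s) inferInstance)) μ)
    (T S : Finset ℕ) {p : ℕ → ℝ} (hp : ∀ s ∈ T, ∀ a, μ.real {ω | f s ω = some a} = p s) (a₀ : P)
    {A : Set Ω} (hA : A = {ω | ∀ s ∈ T, (f s ω).isSome = decide (s ∈ S)}) (hA0 : μ A ≠ 0) :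
    iIndepFun (fun (i : T) ω => ((f i ω).getD a₀, ε i ω)) μ[|A] ∧
      ∀ i : T, (i : ℕ) ∈ S → (μ[|A]).map (fun ω => ((f i ω).getD a₀, ε i ω)) =
        (uniformOn Set.univ).prod (μ.map (ε i)) := by
  let : MeasurableSpace (Option P) := ⊤
  have hfm : ∀ s, Measurable (f s) := fun s => measurable_to_countable' fun a => hf s a
  have hpair := iIndepFun_prodMk_of_sum hfm hε hind
  set g : Option P × ℝ → (P × ℝ) × Bool := fun z => ((z.1.getD a₀, z.2), z.1.isSome) with hg
  have hgm : Measurable g :=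
    (((measurable_from_top (f := fun z : Option P => z.getD a₀)).comp measurable_fst).prodMk
      measurable_snd).prodMk ((measurable_from_top (f := fun z : Option P => z.isSome)).comp
        measurable_fst)
  set X : T → Ω → P × ℝ := fun i ω => ((f i ω).getD a₀, ε i ω) with hX
  set Y : T → Ω → Bool := fun i ω => (f i ω).isSome with hY
  have hXY : iIndepFun (fun i ω => (X i ω, Y i ω)) μ :=
    (hpair.precomp (g := ((↑) : T → ℕ)) Subtype.val_injective).comp (fun _ => g) fun _ => hgm
  have hXYm : ∀ i, Measurable fun ω => (X i ω, Y i ω) := fun i =>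
    hgm.comp ((hfm i).prodMk (hε i))
  have hXm : ∀ i, Measurable (X i) := fun i => measurable_fst.comp (hXYm i)
  have hYm : ∀ i, Measurable (Y i) := fun i => measurable_snd.comp (hXYm i)
  have hA' : A = ⋂ i, Y i ⁻¹' {decide ((i : ℕ) ∈ S)} := by
    rw [hA]; ext ω; simp [hY]
  have hy : ∀ i, μ (Y i ⁻¹' {decide ((i : ℕ) ∈ S)}) ≠ 0 := fun i h0 =>
    hA0 (measure_mono_null (by rw [hA']; exact Set.iInter_subset _ i) h0)
  refine ⟨?_, fun i hi => ?_⟩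
  · rw [hA']
    exact iIndepFun.cond hYm hXY hy fun _ => measurableSet_singleton _
  · have hYi : Y i ⁻¹' {decide ((i : ℕ) ∈ S)} = {ω | (f i ω).isSome = true} := by
      ext ω; simp [hY, hi]
    have hYi0 : μ {ω | (f i ω).isSome = true} ≠ 0 := hYi ▸ hy i
    have hEm : MeasurableSet {ω | (f i ω).isSome = true} :=
      hYi ▸ hYm i (measurableSet_singleton _)
    refine (Measure.prod_eq fun B C hB hC => ?_).symm
    have hBC : MeasurableSet (B ×ˢ C) := hB.prod hC
    rw [Measure.map_apply (hXm i) hBC, Measure.map_apply (hε i) hC]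
    have h1 := cond_iInter (s := {i}) (f := fun i => X i ⁻¹' (B ×ˢ C)) hYm hXY
      (fun j _ => ⟨_, hBC, rfl⟩) (fun j _ => hy j) fun j => measurableSet_singleton _
    simp only [Finset.mem_singleton, Set.iInter_iInter_eq_left, Finset.prod_singleton] at h1
    rw [hA', h1, hYi, ← cond_isSome_eq_uniformOn (hf i) (hp i i.2) hYi0 a₀ B, cond_apply hEm,
      cond_apply hEm, mul_assoc]
    congr 1
    have hfe : IndepFun (f i) (ε i) μ :=
      hind.indep (i := Sum.inl (i : ℕ)) (j := Sum.inr (i : ℕ)) (by simp)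
    have h2 := hfe.measure_inter_preimage_eq_mul {b : Option P | b.isSome = true ∧ b.getD a₀ ∈ B} C
      trivial hC
    have e1 : {ω | (f i ω).isSome = true} ∩ X i ⁻¹' (B ×ˢ C) =
        f i ⁻¹' {b : Option P | b.isSome = true ∧ b.getD a₀ ∈ B} ∩ ε i ⁻¹' C := by
      ext ω; simp [hX, and_assoc]
    rw [e1, h2]
    rfl

end Conditioning

/-! ### Halves of a set of rounds -/

lemma card_firstHalf (J : Finset ℕ) : (firstHalf J).card = J.card / 2 := by
  set e := J.orderEmbOfFin rfl with he
  have hJ : J = Finset.univ.map e.toEmbedding := (Finset.map_orderEmbOfFin_univ J rfl).symm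
  have hfilter : ∀ (p : ℕ → Prop) [DecidablePred p],
      J.filter p = (Finset.univ.filter (p ∘ e.toEmbedding)).map e.toEmbedding := fun p _ =>
    (congrArg (Finset.filter p) hJ).trans Finset.filter_map
  have hrank : ∀ i, (J.filter fun s' => s' < e i).card = i := by
    intro i
    rw [hfilter, Finset.card_map]
    have : Finset.univ.filter ((fun s' => s' < e i) ∘ e.toEmbedding) = Finset.Iio i := by
      ext i'; simp
    rw [this, Fin.card_Iio]
  rw [firstHalf, hfilter, Finset.card_map]
  have : Finset.univ.filter
      ((fun s => (J.filter fun s' => s' < s).card < J.card / 2) ∘ e.toEmbedding) =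
      Finset.univ.filter fun i : Fin J.card => (i : ℕ) < J.card / 2 := by
    ext i; simp [hrank]
  rw [this, Fin.card_filter_val_lt]
  omega

lemma card_secondHalf (J : Finset ℕ) : (secondHalf J).card = J.card - J.card / 2 := by
  have h : firstHalf J ⊆ J := Finset.filter_subset _ _
  rw [secondHalf, Finset.card_sdiff_of_subset h, card_firstHalf]

/-! ### Row enhancement on a given set of rounds -/

/-- The favourable event for row `j` when the forced rounds are `S`: the low-rank estimator on the
first half is within `δ` of `B`, and on the second half every entry `(j, k)` is observed at least a
fraction `κ` of the time with noise sum at most a fraction `η`. -/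
def GoodSample (Bbar : Estimator dr dc) (B : Matrix (Fin dr) (Fin dc) ℝ) (δ κ η : ℝ) (j : Fin dr)
    (S : Finset ℕ) (arm : ℕ → Fin dr × Fin dc) (ε : ℕ → ℝ) : Prop :=
  frobNorm (Bbar (firstHalf S).card (observations arm (fun s => B (arm s).1 (arm s).2 + ε s)
      (firstHalf S)) - B) < δ ∧
    ∀ k, κ * (secondHalf S).card ≤ ∑ s ∈ secondHalf S, (if arm s = (j, k) then (1 : ℝ) else 0) ∧
      |∑ s ∈ secondHalf S, if arm s = (j, k) then ε s else 0| ≤ η * (secondHalf S).card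

lemma GoodSample.congr {Bbar : Estimator dr dc} {B : Matrix (Fin dr) (Fin dc) ℝ} {δ κ η : ℝ}
    {j : Fin dr} {S : Finset ℕ} {arm arm' : ℕ → Fin dr × Fin dc} {ε : ℕ → ℝ}
    (h : GoodSample Bbar B δ κ η j S arm ε) (harm : ∀ s ∈ S, arm s = arm' s) :
    GoodSample Bbar B δ κ η j S arm' ε := by
  have h1 : firstHalf S ⊆ S := Finset.filter_subset _ _
  have h2 : secondHalf S ⊆ S := Finset.sdiff_subset
  have hobs : observations arm (fun s => B (arm s).1 (arm s).2 + ε s) (firstHalf S) =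
      observations arm' (fun s => B (arm' s).1 (arm' s).2 + ε s) (firstHalf S) := by
    funext i
    simp only [observations, harm _ (h1 (Finset.orderEmbOfFin_mem _ rfl i))]
  refine ⟨hobs ▸ h.1, fun k => ⟨(h.2 k).1.trans_eq ?_, le_of_eq_of_le (congrArg abs ?_) (h.2 k).2⟩⟩
  · exact Finset.sum_congr rfl fun s hs => by rw [harm s (h2 hs)]
  · exact Finset.sum_congr rfl fun s hs => by rw [harm s (h2 hs)]

/-- On the favourable event, every output of the row enhancement is accurate in row `j`. -/
lemma GoodSample.rowNorm_le {Bbar : Estimator dr dc} {B : Matrix (Fin dr) (Fin dc) ℝ} {κ H : ℝ}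
    {j : Fin dr} {S : Finset ℕ} {arm : ℕ → Fin dr × Fin dc} {ε : ℕ → ℝ} (hκ : 0 < κ) (hκ1 : κ ≤ 1)
    (hH : 0 < H) (hS : 0 < S.card)
    (h : GoodSample Bbar B (κ * H / 8) κ (κ * H / (8 * dc)) j S arm ε)
    {Bhat : Matrix (Fin dr) (Fin dc) ℝ}
    (hB : IsRowEnhancement B.rank Bbar arm (fun s => B (arm s).1 (arm s).2 + ε s) S Bhat) :
    rowNorm (Bhat - B) j ≤ H := by
  obtain ⟨U, D, V, hSVD, hrow⟩ := hB
  obtain ⟨θ, hθ, hBj⟩ := hrow j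
  obtain ⟨θ₀, hθ₀⟩ := hSVD.exists_firstCols_mulVec_near (B := B) le_rfl j
  have hJ : 0 < (secondHalf S).card := by rw [card_secondHalf]; omega
  have hbias : ∑ k, ((firstCols V B.rank).mulVec θ₀ k - B j k) ^ 2 ≤ (κ * H / 4) ^ 2 := by
    refine hθ₀.trans ?_
    calc _ ≤ 4 * (κ * H / 8) ^ 2 := by
          gcongr
          · exact Real.sqrt_nonneg _
          · exact h.1.le
      _ = _ := by ring
  have key := sum_sq_leastSquares_error_le (firstCols V B.rank) arm B ε (secondHalf S) j θ θ₀ hJ hκ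
    hκ1 hH (hθ θ₀) (fun k => (h.2 k).1) (fun k => ?_) hbias
  · refine (Real.sqrt_le_left hH.le).2 (le_trans (le_of_eq ?_) key)
    refine Finset.sum_congr rfl fun k _ => ?_
    rw [Matrix.sub_apply, hBj]
  · have hdc : (0 : ℝ) < dc := by exact_mod_cast k.pos
    calc (dc : ℝ) * _ ≤ dc * (κ * H / (8 * dc) * (secondHalf S).card) := by
          gcongr; exact (h.2 k).2
      _ = _ := by field_simp

/-! ### Probability of the favourable event -/

section Probability

variable {Ω : Type*} [MeasurableSpace Ω] {μ : Measure Ω} [IsProbabilityMeasure μ]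
  {f : ℕ → Ω → Option (Fin dr × Fin dc)} {ε : ℕ → Ω → ℝ}

/-- Conditionally on the set `S` of forced rounds, the favourable event fails with probability at
most `4 t⁻³`, if `S` has at least `ρ log t / 8` elements and `ρ` is large enough. -/
lemma cond_not_goodSample_le {Bbar : Estimator dr dc} {B : Matrix (Fin dr) (Fin dc) ℝ}
    {α₁ α₂ δ κ η ρ : ℝ} {t : ℕ} (hf : ∀ s a, MeasurableSet {ω | f s ω = a})
    (hε : ∀ s, Measurable (ε s)) (hsub : ∀ s, 1 ≤ s → HasSubgaussianMGF (ε s) 1 μ)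
    (hind : iIndep (Sum.elim (fun s : ℕ => MeasurableSpace.comap (f s) ⊤)
          (fun s : ℕ => MeasurableSpace.comap (ε s) inferInstance)) μ)
    {p : ℕ → ℝ} (hp : ∀ s ∈ Finset.Icc 1 t, ∀ a, μ.real {ω | f s ω = some a} = p s)
    (htail : TailBound Bbar B (fun s => μ.map (ε s)) α₁ α₂) (a₀ : Fin dr × Fin dc) (j : Fin dr)
    {S : Finset ℕ} (hS : S ⊆ Finset.Icc 1 t)
    {A : Set Ω} (hA : A = {ω | ∀ s ∈ Finset.Icc 1 t, (f s ω).isSome = decide (s ∈ S)})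
    (hA0 : μ A ≠ 0) (hδ : 0 < δ) (hη : 0 ≤ η) (hκ : κ * (2 * (dr * dc)) = 1) (hα₁ : 0 < α₁)
    (hrank : 1 ≤ B.rank) (hρ32 : 32 ≤ ρ) (hρt : ρ ≤ t) (hSρ : ρ * Real.log t / 8 ≤ S.card)
    (h1 : 32 * (α₂ * (1 + (δ ^ 2)⁻¹) * B.rank * (dr + dc)) ≤ ρ)
    (h2 : 96 * ((dr + dc) * B.rank) ≤ α₁ * δ ^ 2 * ρ)
    (h3 : 64 ≤ κ ^ 2 * ρ) (h4 : 256 ≤ η ^ 2 * ρ) (h5 : dc ≤ ρ) :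
    (μ[|A]).real {ω | ¬ GoodSample Bbar B δ κ η j S (fun s => (f s ω).getD a₀)
      (fun s => ε s ω)} ≤ 4 * ((t : ℝ) ^ 3)⁻¹ := by
  obtain ⟨hX, hlaw⟩ := cond_rounds hf hε hind (Finset.Icc 1 t) S hp a₀ hA hA0
  have hν := hX.isProbabilityMeasure
  have hXm : ∀ s, Measurable fun ω => ((f s ω).getD a₀, ε s ω) := fun s => by
    let : MeasurableSpace (Option (Fin dr × Fin dc)) := ⊤
    have hfm : Measurable (f s) := measurable_to_countable' fun a => hf s a
    exact ((measurable_from_top (f := fun z : Option (Fin dr × Fin dc) => z.getD a₀)).comp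
      hfm).prodMk (hε s)
  have hprob : ∀ s, IsProbabilityMeasure (μ.map (ε s)) := fun s =>
    Measure.isProbabilityMeasure_map (hε s).aemeasurable
  have : Nonempty (Fin dr × Fin dc) := ⟨a₀⟩
  have hJ₁ : firstHalf S ⊆ S := Finset.filter_subset _ _
  have hJ₂ : secondHalf S ⊆ S := Finset.sdiff_subset
  have hdr : (0 : ℝ) < dr := by exact_mod_cast a₀.1.pos
  have hdc : (0 : ℝ) < dc := by exact_mod_cast a₀.2.pos
  have hr : (1 : ℝ) ≤ B.rank := by exact_mod_cast hrank
  have ht0 : (0 : ℝ) < t := by linarith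
  have hL : 2 ≤ Real.log t := by
    rw [Real.le_log_iff_exp_le ht0]
    have := Real.exp_one_lt_d9
    have e : Real.exp 2 = Real.exp 1 * Real.exp 1 := by rw [← Real.exp_add]; norm_num
    rw [e]
    nlinarith [Real.exp_pos 1]
  have hpow : ∀ n : ℕ, Real.exp (-(n * Real.log t)) = ((t : ℝ) ^ n)⁻¹ := fun n => by
    rw [Real.exp_neg, Real.exp_nat_mul, Real.exp_log ht0]
  -- Both halves of `S` have at least `ρ log t / 32` elements.
  have hSN : (4 : ℝ) ≤ S.card := by nlinarith
  have hSN' : 4 ≤ S.card := by exact_mod_cast hSN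
  have hn₁ : ρ * Real.log t / 32 ≤ (firstHalf S).card := by
    have h : S.card ≤ 4 * (firstHalf S).card := by rw [card_firstHalf]; omega
    have h' : (S.card : ℝ) ≤ 4 * (firstHalf S).card := by exact_mod_cast h
    linarith
  have hn₂ : ρ * Real.log t / 32 ≤ (secondHalf S).card := by
    have h : S.card ≤ 4 * (secondHalf S).card := by rw [card_secondHalf]; omega
    have h' : (S.card : ℝ) ≤ 4 * (secondHalf S).card := by exact_mod_cast h
    linarith
  have hE : (μ[|A]).real {ω | δ ≤ frobNorm (Bbar (firstHalf S).card (observations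
      (fun s => (f s ω).getD a₀) (fun s => B ((f s ω).getD a₀).1 ((f s ω).getD a₀).2 + ε s ω)
      (firstHalf S)) - B)} ≤ ((t : ℝ) ^ 3)⁻¹ := by
    set n := (firstHalf S).card with hn
    set e := (firstHalf S).orderEmbOfFin hn.symm with he
    have heS : ∀ i, e i ∈ S := fun i => hJ₁ (Finset.orderEmbOfFin_mem _ _ i)
    have hn2 : 2 ≤ n := by rw [hn, card_firstHalf]; omega
    have hn0 : (0 : ℝ) < n := by exact_mod_cast (by omega : 0 < n)
    have hnt : n ≤ t := by
      have h1 := Finset.card_le_card (hJ₁.trans hS)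
      rwa [Nat.card_Icc, Nat.add_sub_cancel] at h1
    have hlogn : 0 < Real.log n := Real.log_pos (by exact_mod_cast hn2)
    have hlogt : Real.log n ≤ Real.log t := Real.log_le_log hn0 (by exact_mod_cast hnt)
    have hb := htail n e hn2 e.strictMono (fun i => (Finset.mem_Icc.1 (hS (heS i))).1) δ hδ (by
      rw [le_div_iff₀ hlogn]
      have hρL : ρ / 32 * Real.log n ≤ ρ / 32 * Real.log t := by gcongr
      have h6 : α₂ * (1 + (δ ^ 2)⁻¹) * B.rank * (dr + dc) * Real.log n ≤
          ρ / 32 * Real.log n := mul_le_mul_of_nonneg_right (by linarith) hlogn.le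
      linarith)
    -- The joint law of the observations of the first half is the one in the tail bound.
    have hmap : (μ[|A]).map (fun ω (i : Fin n) => ((f (e i) ω).getD a₀, ε (e i) ω)) =
        Measure.pi fun i : Fin n => (uniformOn Set.univ).prod (μ.map (ε (e i))) := by
      have hinj : Function.Injective fun i : Fin n =>
          (⟨e i, hS (heS i)⟩ : Finset.Icc 1 t) := fun i i' h =>
        e.injective (Subtype.mk.inj h)
      rw [(iIndepFun_iff_map_fun_eq_pi_map fun i => (hXm (e i)).aemeasurable).1 (hX.precomp hinj)]
      congr 1
      funext i
      exact hlaw ⟨e i, hS (heS i)⟩ (heS i)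
    rw [← hmap] at hb
    have hb' := (Measure.le_map_apply (measurable_pi_lambda _ fun i =>
      hXm (e i)).aemeasurable _).trans hb
    refine (ENNReal.toReal_le_of_le_ofReal (Real.exp_pos _).le hb').trans ?_
    rw [← hpow 3]
    refine Real.exp_le_exp.2 (neg_le_neg ?_)
    rw [le_div_iff₀ (by positivity)]
    have h6 : α₁ * δ ^ 2 * (ρ * Real.log t / 32) ≤ α₁ * δ ^ 2 * n :=
      mul_le_mul_of_nonneg_left hn₁ (by positivity)
    have h7 := mul_le_mul_of_nonneg_right h2 (by linarith : 0 ≤ Real.log t)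
    push_cast
    linarith
  have hinj₂ : Function.Injective fun i : secondHalf S =>
      (⟨i, hS (hJ₂ i.2)⟩ : Finset.Icc 1 t) := fun i i' h =>
    Subtype.ext (Subtype.mk.inj h)
  have hX₂ := hX.precomp hinj₂
  have hlaw₂ := fun i : secondHalf S => hlaw ⟨i, hS (hJ₂ i.2)⟩ (hJ₂ i.2)
  have hC : ∀ k, (μ[|A]).real {ω | ∑ s ∈ secondHalf S,
      (if (f s ω).getD a₀ = (j, k) then (1 : ℝ) else 0) ≤ κ * (secondHalf S).card} ≤
      ((t : ℝ) ^ 4)⁻¹ := by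
    intro k
    have h := measureReal_count_le (fun i : secondHalf S => hXm i) hX₂ (fun i => hprob i) hlaw₂
      (j, k) (κ := κ) (by rw [← hκ]; simp)
    rw [Fintype.card_coe] at h
    simp_rw [← Finset.sum_coe_sort (secondHalf S)]
    refine h.trans ?_
    rw [← hpow 4]
    refine Real.exp_le_exp.2 (neg_le_neg ?_)
    have h6 := mul_le_mul_of_nonneg_left hn₂ (by positivity : 0 ≤ 2 * κ ^ 2)
    have h7 := mul_le_mul_of_nonneg_right h3 (by linarith : 0 ≤ Real.log t)
    push_cast
    linarith
  have hN : ∀ k, (μ[|A]).real {ω | η * (secondHalf S).card ≤ |∑ s ∈ secondHalf S,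
      if (f s ω).getD a₀ = (j, k) then ε s ω else 0|} ≤ 2 * ((t : ℝ) ^ 4)⁻¹ := by
    intro k
    have h := measureReal_abs_noise_sum_ge_le (fun i : secondHalf S => hXm i) hX₂
      (fun i => hprob i) hlaw₂ (fun i => (HasSubgaussianMGF.id_map_iff (hε i).aemeasurable).2
        (hsub i (Finset.mem_Icc.1 (hS (hJ₂ i.2))).1)) (j, k) hη
    rw [Fintype.card_coe] at h
    simp_rw [← Finset.sum_coe_sort (secondHalf S)]
    refine h.trans ?_
    rw [← hpow 4]
    gcongr
    have h6 := mul_le_mul_of_nonneg_left hn₂ (by positivity : 0 ≤ η ^ 2)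
    have h7 := mul_le_mul_of_nonneg_right h4 (by linarith : 0 ≤ Real.log t)
    push_cast
    linarith
  set E := {ω | δ ≤ frobNorm (Bbar (firstHalf S).card (observations
      (fun s => (f s ω).getD a₀) (fun s => B ((f s ω).getD a₀).1 ((f s ω).getD a₀).2 + ε s ω)
      (firstHalf S)) - B)} with hEdef
  set C := fun k => {ω | ∑ s ∈ secondHalf S,
      (if (f s ω).getD a₀ = (j, k) then (1 : ℝ) else 0) ≤ κ * (secondHalf S).card} with hCdef
  set N := fun k => {ω | η * (secondHalf S).card ≤ |∑ s ∈ secondHalf S,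
      if (f s ω).getD a₀ = (j, k) then ε s ω else 0|} with hNdef
  have hcover : {ω | ¬ GoodSample Bbar B δ κ η j S (fun s => (f s ω).getD a₀)
      (fun s => ε s ω)} ⊆ E ∪ ⋃ k ∈ Finset.univ, (C k ∪ N k) := by
    intro ω hω
    by_contra hcon
    simp only [Set.mem_union, Set.mem_iUnion, Finset.mem_univ, not_or, not_exists, exists_prop,
      true_and] at hcon
    exact hω ⟨not_le.1 hcon.1, fun k => ⟨(not_le.1 (hcon.2 k).1).le, (not_le.1 (hcon.2 k).2).le⟩⟩
  calc _ ≤ _ := measureReal_mono hcover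
    _ ≤ _ := measureReal_union_le _ _
    _ ≤ ((t : ℝ) ^ 3)⁻¹ + ∑ _k : Fin dc, (((t : ℝ) ^ 4)⁻¹ + 2 * ((t : ℝ) ^ 4)⁻¹) := by
        refine add_le_add hE ((measureReal_biUnion_finset_le _ _).trans ?_)
        exact Finset.sum_le_sum fun k _ =>
          (measureReal_union_le _ _).trans (add_le_add (hC k) (hN k))
    _ = ((t : ℝ) ^ 3)⁻¹ + 3 * (dc / t) * ((t : ℝ) ^ 3)⁻¹ := by
        rw [Finset.sum_const, Finset.card_univ, Fintype.card_fin, nsmul_eq_mul]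
        field_simp
        ring
    _ ≤ ((t : ℝ) ^ 3)⁻¹ + 3 * 1 * ((t : ℝ) ^ 3)⁻¹ := by
        gcongr
        rw [div_le_one ht0]
        linarith
    _ = _ := by ring

/-- Outside an event of probability `t⁻³`, at least `ρ log t / 8` rounds are forced. -/
lemma measureReal_card_forcedRounds_le (hf : ∀ s a, MeasurableSet {ω | f s ω = a})
    (hε : ∀ s, Measurable (ε s))
    (hind : iIndep (Sum.elim (fun s : ℕ => MeasurableSpace.comap (f s) ⊤)
          (fun s : ℕ => MeasurableSpace.comap (ε s) inferInstance)) μ)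
    (hdr : 0 < dr) (hdc : 0 < dc) {ρ : ℝ} (hρ : 32 ≤ ρ) {t : ℕ}
    (ht : 2 * ρ * Real.log ρ ≤ t)
    (hp : ∀ s, 1 ≤ s → ∀ a, μ.real {ω | f s ω = some a} = forcedProb dr dc ρ s) :
    μ.real {ω | ((forcedRounds (fun s => f s ω) t).card : ℝ) ≤ ρ * Real.log t / 8} ≤
      ((t : ℝ) ^ 3)⁻¹ := by
  have hlogρ : 1 ≤ Real.log ρ := by
    rw [Real.le_log_iff_exp_le (by linarith)]
    have := Real.exp_one_lt_d9
    linarith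
  have ht0 : (32 : ℝ) ≤ t := by nlinarith
  have hL : 0 ≤ Real.log t := Real.log_natCast_nonneg t
  let : MeasurableSpace (Option (Fin dr × Fin dc)) := ⊤
  have hfm : ∀ s, Measurable (f s) := fun s => measurable_to_countable' fun a => hf s a
  have hpair := iIndepFun_prodMk_of_sum hfm hε hind
  set g : Option (Fin dr × Fin dc) × ℝ → ℝ := fun z => if z.1.isSome then 1 else 0 with hg
  have hgm : Measurable g :=
    (measurable_from_top (f := fun z : Option (Fin dr × Fin dc) =>
      if z.isSome then (1 : ℝ) else 0)).comp measurable_fst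
  have h := measureReal_sum_indicator_le (Y := fun s ω => g (f s ω, ε s ω))
    (fun s => hgm.comp ((hfm s).prodMk (hε s))) (hpair.comp (fun _ => g) fun _ => hgm)
    (fun s ω => by simp only [hg]; split_ifs <;> simp) (Finset.Icc 1 t) (ρ * Real.log t / 8)
  have hcard : ∀ ω, ∑ s ∈ Finset.Icc 1 t, g (f s ω, ε s ω) =
      (forcedRounds (fun s => f s ω) t).card := fun ω => by
    simp only [hg, forcedRounds, Finset.sum_boole]
  have hmean : ∑ s ∈ Finset.Icc 1 t, μ[fun ω => g (f s ω, ε s ω)] =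
      ∑ s ∈ Finset.Icc 1 t, (dr * dc : ℝ) * forcedProb dr dc ρ s := by
    refine Finset.sum_congr rfl fun s hs => ?_
    have e : (fun ω => g (f s ω, ε s ω)) = {ω | (f s ω).isSome = true}.indicator 1 := by
      ext ω; simp [hg, Set.indicator_apply]
    rw [e, integral_indicator_one (measurableSet_isSome (hf s)),
      measureReal_isSome (hf s) (hp s (Finset.mem_Icc.1 hs).1)]
    simp
  simp only [hcard] at h
  rw [hmean] at h
  refine h.trans ?_
  have hsum := le_sum_forcedProb hdr hdc hρ ht
  have e3 : ((t : ℝ) ^ 3)⁻¹ = Real.exp (-((3 : ℕ) * Real.log t)) := by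
    rw [Real.exp_neg, Real.exp_nat_mul, Real.exp_log (by linarith)]
  rw [e3]
  refine Real.exp_le_exp.2 ?_
  push_cast
  nlinarith

/-- Outside an event of probability `5 t⁻³`, the set of forced rounds is large and the sample is
favourable. -/
lemma measureReal_not_goodSample_le {Bbar : Estimator dr dc} {B : Matrix (Fin dr) (Fin dc) ℝ}
    {α₁ α₂ δ κ η ρ : ℝ} {t : ℕ} (hf : ∀ s a, MeasurableSet {ω | f s ω = a})
    (hε : ∀ s, Measurable (ε s)) (hsub : ∀ s, 1 ≤ s → HasSubgaussianMGF (ε s) 1 μ)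
    (hind : iIndep (Sum.elim (fun s : ℕ => MeasurableSpace.comap (f s) ⊤)
          (fun s : ℕ => MeasurableSpace.comap (ε s) inferInstance)) μ)
    (hp : ∀ s, 1 ≤ s → ∀ a, μ.real {ω | f s ω = some a} = forcedProb dr dc ρ s)
    (htail : TailBound Bbar B (fun s => μ.map (ε s)) α₁ α₂) (a₀ : Fin dr × Fin dc) (j : Fin dr)
    (hδ : 0 < δ) (hη : 0 ≤ η) (hκ : κ * (2 * (dr * dc)) = 1) (hα₁ : 0 < α₁)
    (hrank : 1 ≤ B.rank) (hρ32 : 32 ≤ ρ) (ht : 2 * ρ * Real.log ρ ≤ t)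
    (h1 : 32 * (α₂ * (1 + (δ ^ 2)⁻¹) * B.rank * (dr + dc)) ≤ ρ)
    (h2 : 96 * ((dr + dc) * B.rank) ≤ α₁ * δ ^ 2 * ρ)
    (h3 : 64 ≤ κ ^ 2 * ρ) (h4 : 256 ≤ η ^ 2 * ρ) (h5 : dc ≤ ρ) :
    μ.real {ω | ¬ (ρ * Real.log t / 8 < (forcedRounds (fun s => f s ω) t).card ∧
      GoodSample Bbar B δ κ η j (forcedRounds (fun s => f s ω) t) (fun s => (f s ω).getD a₀)
        (fun s => ε s ω))} ≤ 5 * ((t : ℝ) ^ 3)⁻¹ := by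
  have hlogρ : 1 ≤ Real.log ρ := by
    rw [Real.le_log_iff_exp_le (by linarith)]
    have := Real.exp_one_lt_d9
    linarith
  have hρt : ρ ≤ t := by nlinarith
  set c : ℝ := ρ * Real.log t / 8 with hc
  set A : Finset ℕ → Set Ω := fun S =>
    {ω | ∀ s ∈ Finset.Icc 1 t, (f s ω).isSome = decide (s ∈ S)} with hA
  set G : Finset ℕ → Set Ω := fun S => {ω | ¬ GoodSample Bbar B δ κ η j S
    (fun s => (f s ω).getD a₀) (fun s => ε s ω)} with hG
  set F : Finset (Finset ℕ) := (Finset.Icc 1 t).powerset.filter fun S => c ≤ S.card with hF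
  have hAm : ∀ S, MeasurableSet (A S) := by
    intro S
    have : A S = ⋂ s ∈ Finset.Icc 1 t, {ω | (f s ω).isSome = decide (s ∈ S)} := by
      ext ω; simp [hA]
    rw [this]
    refine Finset.measurableSet_biInter _ fun s _ => ?_
    by_cases hs : s ∈ S
    · simpa [hs] using measurableSet_isSome (hf s)
    · have e : {ω | (f s ω).isSome = decide (s ∈ S)} = {ω | f s ω = none} := by
        ext ω; simp [hs]
      rw [e]
      exact hf s none
  -- Decompose the bad event according to the value `S` of the set of forced rounds.
  have hcover : {ω | ¬ (c < (forcedRounds (fun s => f s ω) t).card ∧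
      GoodSample Bbar B δ κ η j (forcedRounds (fun s => f s ω) t) (fun s => (f s ω).getD a₀)
        (fun s => ε s ω))} ⊆
      {ω | ((forcedRounds (fun s => f s ω) t).card : ℝ) ≤ c} ∪ ⋃ S ∈ F, (A S ∩ G S) := by
    intro ω hω
    by_cases hcard : ((forcedRounds (fun s => f s ω) t).card : ℝ) ≤ c
    · exact Or.inl hcard
    · refine Or.inr (Set.mem_biUnion (x := forcedRounds (fun s => f s ω) t) ?_ ⟨?_, ?_⟩)
      · rw [hF, Finset.mem_coe, Finset.mem_filter, Finset.mem_powerset]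
        exact ⟨Finset.filter_subset _ _, (not_le.1 hcard).le⟩
      · intro s hs
        simp only [forcedRounds, Finset.mem_filter, hs, true_and, Bool.decide_eq_true]
      · exact fun hgood => hω ⟨not_le.1 hcard, hgood⟩
  have hAG : ∀ S ∈ F, μ.real (A S ∩ G S) ≤ μ.real (A S) * (4 * ((t : ℝ) ^ 3)⁻¹) := by
    intro S hS
    rw [hF, Finset.mem_filter, Finset.mem_powerset] at hS
    by_cases h0 : μ (A S) = 0
    · have : μ (A S ∩ G S) = 0 := measure_mono_null Set.inter_subset_left h0
      simp [measureReal_def, h0, this]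
    · have hcond := cond_not_goodSample_le hf hε hsub hind
        (fun s hs => hp s (Finset.mem_Icc.1 hs).1) htail a₀ j hS.1 rfl h0 hδ hη hκ hα₁ hrank hρ32
        hρt hS.2 h1 h2 h3 h4 h5
      rw [measureReal_def, cond_apply (hAm S), ENNReal.toReal_mul, ENNReal.toReal_inv,
        inv_mul_le_iff₀
        (ENNReal.toReal_pos h0 (measure_ne_top _ _))] at hcond
      exact hcond
  have hdisj : ∑ S ∈ F, μ.real (A S) ≤ 1 := by
    rw [← measureReal_biUnion_finset _ fun S _ => hAm S]
    · exact measureReal_le_one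
    · intro S hS S' hS' hne
      refine Set.disjoint_left.2 fun ω hω hω' => hne ?_
      rw [hF, Finset.mem_coe, Finset.mem_filter, Finset.mem_powerset] at hS hS'
      ext s
      by_cases hs : s ∈ Finset.Icc 1 t
      · simpa using (hω s hs).symm.trans (hω' s hs)
      · exact ⟨fun h => absurd (hS.1 h) hs, fun h => absurd (hS'.1 h) hs⟩
  calc _ ≤ _ := measureReal_mono hcover
    _ ≤ _ := measureReal_union_le _ _
    _ ≤ ((t : ℝ) ^ 3)⁻¹ + ∑ S ∈ F, μ.real (A S) * (4 * ((t : ℝ) ^ 3)⁻¹) :=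
        add_le_add (measureReal_card_forcedRounds_le hf hε hind a₀.1.pos a₀.2.pos hρ32 ht hp)
          ((measureReal_biUnion_finset_le _ _).trans (Finset.sum_le_sum hAG))
    _ ≤ ((t : ℝ) ^ 3)⁻¹ + 1 * (4 * ((t : ℝ) ^ 3)⁻¹) := by
        rw [← Finset.sum_mul]
        gcongr
    _ = _ := by ring

end Probability

end LowRankBandit

/-! ### Choice of the constants -/

theorem lemma1 (dr dc r : ℕ) (hr : 1 ≤ r) (α₁ α₂ : ℝ) (hα₁ : 0 < α₁) (hα₂ : 0 < α₂) :
    ∃ α₃ > (0 : ℝ), ∃ α₄ > (0 : ℝ), ∃ α₅ > (0 : ℝ),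
      ∀ (Bstar : Matrix (Fin dr) (Fin dc) ℝ), Bstar.rank = r →
      ∀ (h : ℝ), 0 < h →
      ∀ (ρ : ℝ),
        max (max 32 (32 * dr / α₃))
          (max (α₄ * (LowRankBandit.gammaRes Bstar h ^ 2)⁻¹) (α₅ / h)) ≤ ρ →
      ∀ (t : ℕ), 2 * ρ * Real.log ρ ≤ t →
      ∀ {Ω : Type*} [MeasurableSpace Ω] (μ : Measure Ω) [IsProbabilityMeasure μ]
        -- forced-sampling rule, noise, executed policy
        (f : ℕ → Ω → Option (Fin dr × Fin dc)) (ε : ℕ → Ω → ℝ) (arm : ℕ → Ω → Fin dr × Fin dc),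
        (∀ s a, MeasurableSet {ω | f s ω = a}) →
        (∀ s, 1 ≤ s → ∀ a : Fin dr × Fin dc,
          μ.real {ω | f s ω = some a} = LowRankBandit.forcedProb dr dc ρ s) →
        (∀ s, Measurable (ε s)) →
        (∀ s, 1 ≤ s → HasSubgaussianMGF (ε s) 1 μ) →
        -- all the choices of the forced-sampling rule and all the noises are mutually independent
        iIndep (Sum.elim (fun s : ℕ => MeasurableSpace.comap (f s) ⊤)
          (fun s : ℕ => MeasurableSpace.comap (ε s) inferInstance)) μ →
        (∀ s ω a, f s ω = some a → arm s ω = a) →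
      ∀ (Bbar : LowRankBandit.Estimator dr dc), Bbar.IsMeasurable →
        LowRankBandit.TailBound Bbar Bstar (fun s => μ.map (ε s)) α₁ α₂ →
      ∀ (Bhat : Ω → Matrix (Fin dr) (Fin dc) ℝ),
        (∀ ω, LowRankBandit.IsRowEnhancement r Bbar (fun s => arm s ω)
          (fun s => Bstar (arm s ω).1 (arm s ω).2 + ε s ω)
          (LowRankBandit.forcedRounds (fun s => f s ω) t) (Bhat ω)) →
      ∀ j : Fin dr, ∃ E : Set Ω, MeasurableSet E ∧ 1 - 9 * ((t : ℝ) ^ 3)⁻¹ ≤ μ.real E ∧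
        ∀ ω ∈ E, LowRankBandit.rowNorm (Bhat ω - Bstar) j ≤ h / 4 := by
  set d : ℝ := 2 * (dr * dc) with hd
  have hd0 : 0 ≤ d := by positivity
  set K₀ : ℝ := 64 * (α₂ * r * (dr + dc)) + 64 * d ^ 2 + dc + 1 with hK₀
  set K : ℝ := 65536 * (α₂ * r * (dr + dc) * d ^ 2) + 98304 * ((dr + dc) * r * d ^ 2 / α₁) +
    262144 * (dc ^ 2 * d ^ 2) + 1 with hK
  have hK₀pos : 0 < K₀ := by positivity
  have hKpos : 0 < K := by positivity
  -- `K₀` and `K` are the lower bounds that are needed on `ρ` and on `ρ h²`.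
  refine ⟨32 / K₀, by positivity, K * (dr + 1), by positivity, 1, one_pos, ?_⟩
  intro B hB h hh ρ hρ t ht Ω _ μ _ f ε arm hf hp hε hsub hind harm Bbar _ htail Bhat hBhat j
  have hrank : 1 ≤ B.rank := hB ▸ hr
  have hdr : (1 : ℝ) ≤ dr := by exact_mod_cast j.pos
  have hdcN : 0 < dc := hrank.trans (by simpa using B.rank_le_width)
  have hdc : (1 : ℝ) ≤ dc := by exact_mod_cast hdcN
  obtain ⟨hρ₁, hρ₂⟩ := max_le_iff.1 hρ
  obtain ⟨hρ32, hρ₁⟩ := max_le_iff.1 hρ₁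
  have hρK₀ : K₀ ≤ ρ := by
    refine le_trans ?_ hρ₁
    rw [show 32 * (dr : ℝ) / (32 / K₀) = dr * K₀ by field_simp]
    nlinarith
  have hρK : K ≤ ρ * h ^ 2 := by
    have e1 := LowRankBandit.inv_sq_gammaRes_ge hrank hh
    have e2 : K / h ^ 2 ≤ ρ := by
      refine le_trans ?_ ((max_le_iff.1 hρ₂).1)
      calc K / h ^ 2 = K * dr * (1 / (dr * h ^ 2)) := by field_simp
        _ ≤ K * (dr + 1) * (4096 / (dr * h ^ 2)) := by gcongr <;> linarith
        _ ≤ _ := by gcongr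
    rwa [div_le_iff₀ (by positivity)] at e2
  have hdpos : 0 < d := by positivity
  have hd1 : 1 ≤ d := by nlinarith
  set κ : ℝ := 1 / d with hκ
  have hκ0 : 0 < κ := by positivity
  have hκ1 : κ ≤ 1 := by rw [hκ, div_le_one hdpos]; exact hd1
  have hH : 0 < h / 4 := by positivity
  have hbad := LowRankBandit.measureReal_not_goodSample_le (δ := κ * (h / 4) / 8) (κ := κ)
    (η := κ * (h / 4) / (8 * dc)) hf hε hsub hind hp htail (j, ⟨0, hdcN⟩) j (by positivity)
    (by positivity) (by rw [hκ, ← hd]; exact one_div_mul_cancel hdpos.ne') hα₁ hrank hρ32 ht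
    ?_ ?_ ?_ ?_ ?_
  · set Bad : Set Ω := {ω | ¬ (ρ * Real.log t / 8 <
        (LowRankBandit.forcedRounds (fun s => f s ω) t).card ∧
      LowRankBandit.GoodSample Bbar B (κ * (h / 4) / 8) κ (κ * (h / 4) / (8 * dc)) j
        (LowRankBandit.forcedRounds (fun s => f s ω) t)
        (fun s => (f s ω).getD (j, ⟨0, hdcN⟩)) (fun s => ε s ω))} with hBad
    -- `Bad` need not be measurable by itself, so its measurable hull is removed.
    refine ⟨(toMeasurable μ Bad)ᶜ, (measurableSet_toMeasurable _ _).compl, ?_, fun ω hω => ?_⟩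
    · rw [probReal_compl_eq_one_sub (measurableSet_toMeasurable _ _)]
      have : μ.real (toMeasurable μ Bad) = μ.real Bad := by
        simp only [measureReal_def, measure_toMeasurable]
      have h0 : 0 ≤ ((t : ℝ) ^ 3)⁻¹ := by positivity
      linarith
    · have hω' : ω ∉ Bad := fun hb => hω (subset_toMeasurable _ _ hb)
      obtain ⟨hcard, hgood⟩ := not_not.1 hω'
      have hlog : 0 ≤ Real.log t := Real.log_natCast_nonneg t
      refine LowRankBandit.GoodSample.rowNorm_le (arm := fun s => arm s ω) hκ0 hκ1 hH ?_
        (hgood.congr fun s hs => ?_) (hB ▸ hBhat ω)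
      · have : 0 ≤ ρ * Real.log t / 8 := by positivity
        exact_mod_cast this.trans_lt hcard
      · obtain ⟨a, ha⟩ := Option.isSome_iff_exists.1 (Finset.mem_filter.1 hs).2
        have ha' : f s ω = some a := ha
        rw [ha', harm s ω a ha, Option.getD_some]
  all_goals
    have hT1 : 0 ≤ α₂ * r * (dr + dc) := by positivity
    have hT2 : 0 ≤ (dr + dc) * r * d ^ 2 / α₁ := by positivity
    have hT3 : 0 ≤ (dc : ℝ) ^ 2 * d ^ 2 := by positivity
    have hT4 : 0 ≤ α₂ * r * (dr + dc) * d ^ 2 := by positivity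
  · rw [hB]
    have e : 32 * (α₂ * (1 + ((κ * (h / 4) / 8) ^ 2)⁻¹) * r * (dr + dc)) =
        32 * (α₂ * r * (dr + dc)) + 32768 * (α₂ * r * (dr + dc) * d ^ 2) / h ^ 2 := by
      rw [hκ]; field_simp; ring
    have e2 : 32768 * (α₂ * r * (dr + dc) * d ^ 2) / h ^ 2 ≤ ρ / 2 := by
      rw [div_le_iff₀ (by positivity)]; linarith
    have e3 : 0 ≤ d ^ 2 := by positivity
    rw [e]; linarith
  · rw [hB]
    have e : α₁ * (κ * (h / 4) / 8) ^ 2 * ρ = α₁ * (ρ * h ^ 2) / (1024 * d ^ 2) := by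
      rw [hκ]; field_simp; norm_num
    have e2 : α₁ * (98304 * ((dr + dc) * r * d ^ 2 / α₁)) ≤ α₁ * (ρ * h ^ 2) :=
      mul_le_mul_of_nonneg_left (by linarith) hα₁.le
    have e3 : α₁ * (98304 * ((dr + dc) * r * d ^ 2 / α₁)) = 98304 * ((dr + dc) * r * d ^ 2) := by
      field_simp
    rw [e, le_div_iff₀ (by positivity)]
    linarith
  · rw [hκ, show (1 / d) ^ 2 * ρ = ρ / d ^ 2 by field_simp, le_div_iff₀ (by positivity)]
    linarith
  · have e : (κ * (h / 4) / (8 * dc)) ^ 2 * ρ = ρ * h ^ 2 / (1024 * (dc ^ 2 * d ^ 2)) := by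
      rw [hκ]; field_simp; norm_num
    rw [e, le_div_iff₀ (by positivity)]
    linarith
  · have e3 : 0 ≤ d ^ 2 := by positivity
    linarith
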